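/- **Setting (finite graphs).** Let $G=(V\cup\{\delta\},E)$ be a finite directed graph without multiple edges and without loops (edges $(x,x)$), in which $\delta\notin V$ is a cemetery vertex: no edge exits $\delta$, and from every vertex there is a directed path to $\delta$. Suppose that $(x,y)\in E$ and $y\neq\delta$ imply $(y,x)\in E$. Let $(\alpha(e))_{e\in E}$ be positive real numbers. A random environment $\omega=(\omega(e))_{e\in E}$ is drawn from the law $\mathbb P^{(\alpha)}$ under which the families $(\omega(x,y))_{y:(x,y)\in E}$, $x\in V$, are independent, the family at $x$ having the Dirichlet law with parameters $(\alpha(x,y))_{y:(x,y)\in E}$. Given $\omega$, let $(Z_n)_{n\ge0}$ be, under $P^\omega_x$, the Markov chain started at $x$ that jumps from $y\in V$ to $z$ with probability $\omega(y,z)$ and stays at $\delta$ once it is there. For $x \in V$ put $$\gamma^\omega(x)=\frac1{P^\omega_x\big(H_\delta<\tilde H_x\wedge L\big)},$$ where $H_\delta=\inf\{n\ge0: Z_n=\delta\}$, $\tilde H_x=\inf\{n\ge1:Z_n=x\}$ and $L=\inf\{n\ge1:\exists\, m<n,\ Z_n=Z_m\}$. For $A\subset E$ let $\underline A$ and $\overline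 A$ be the sets of tails and of heads of the edges in $A$; $A$ is strongly connected if for all $x,y\in\underline A\cup\overline A$ there is a directed path from $x$ to $y$ with edges in $A$. Let $\beta_A$ be the sum of $\alpha(x,y)$ over the edges $(x,y)\in E$ with $x\in\underline A$ and $y\notin\underline A$. **Theorem.** (1) Let $0\in V$, and let $\beta=\min_A\beta_A$, where the minimum is over the strongly connected sets $A\subset E$ with $0\in\underline A$. If there is such a set $A$, then there are constants $C,r>0$ such that, for all $t$ large enough, $$\mathbb P^{(\alpha)}\big(\gamma^\omega(0)>t\big)\le C\,\frac{(\ln t)^r}{t^{\beta}}.$$ If there is no such set $A$ (that is, $\beta=+\infty$), then $\mathbb P^{(\alpha)}(\gamma^\omega(0)>t)=0$ for all $t$ large enough. (2) Let $d\ge1$, let $e_1,\dots,e_d$ be the canonical basis of $\mathbb Z^d$ and $e_{i+d}=-e_i$, let $\alpha_1,\dots,\alpha_{2d}>0$, and let $\mathbb P^{(\alpha)}$ be the law of the environment on $\mathbb Z^d$ for which the vectors $(\omega(x,x+e_i))_{1\le i\le 2d}$, $x\in\mathbb Z^d$, are i.i.d. with the Dirichlet law with parameters $(\alpha_1,\dots,\alpha_{2d})$.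 Let $\Lambda\subset\mathbb Z^d$ be a finite connected set that contains the origin, and let $\gamma^\omega(x)=1/\sum_\sigma\omega_\sigma$, where the sum is over the simple nearest-neighbour paths $\sigma$ that start at $x$ and stop just after exiting $x+\Lambda$, and $\omega_\sigma$ is the product of $\omega(e)$ over the edges $e$ of $\sigma$. Put $$\kappa=2\sum_{i=1}^{2d}\alpha_i-\max_{1\le i\le d}(\alpha_i+\alpha_{i+d}).$$ Then $\mathbb E^{(\alpha)}\big[\gamma^\omega(x)^s\big]<\infty$ for all $x\in\mathbb Z^d$ and all real $s<\kappa$. -/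

import Mathlib

open MeasureTheory ProbabilityTheory Filter
open scoped ENNReal

noncomputable section

namespace RWDE

/-! ### Dirichlet laws -/

/-- The open simplex `{x ∈ (0,1]^ι : ∑ i, x i = 1}` (the bound `x i ≤ 1` is automatic). -/
def openSimplex (ι : Type*) [Fintype ι] : Set (ι → ℝ) :=
  {x | (∀ i, 0 < x i) ∧ ∑ i, x i = 1}

/-- The open simplex as a type. -/
abbrev Simplex (ι : Type*) [Fintype ι] : Type _ := openSimplex ι

open scoped Classical in
/-- The map that completes a vector indexed by `ι ∖ {i₀}` by the coordinate
`x i₀ = 1 - ∑_{j ≠ i₀} x j`. -/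
def complete {ι : Type*} [Fintype ι] (i₀ : ι) (x : {i : ι // i ≠ i₀} → ℝ) : ι → ℝ :=
  fun i => if h : i = i₀ then 1 - ∑ j, x j else x ⟨i, h⟩

open scoped Classical in
/-- The measure `∏_{j ≠ i₀} dx_j` on the simplex: the image of Lebesgue measure under
the completion map, restricted to the simplex. -/
def simplexMeasure {ι : Type*} [Fintype ι] (i₀ : ι) : Measure (Simplex ι) :=
  ((volume : Measure ({i : ι // i ≠ i₀} → ℝ)).map (complete i₀)).comap Subtype.val

/-- The Dirichlet density with parameters `α`. -/
def dirichletDensity {ι : Type*} [Fintype ι] (α : ι → ℝ) (x : Simplex ι) : ℝ≥0∞ :=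
  ENNReal.ofReal
    (Real.Gamma (∑ i, α i) / (∏ i, Real.Gamma (α i)) * ∏ i, x.1 i ^ (α i - 1))

open scoped Classical in
/-- The Dirichlet law with parameters `α` (a law on a nonempty index set; the law does not
depend on the coordinate that is eliminated). -/
def dirichlet {ι : Type*} [Fintype ι] (α : ι → ℝ) : Measure (Simplex ι) :=
  if h : Nonempty ι then (simplexMeasure h.some).withDensity (dirichletDensity α) else 0

/-! ### Finite directed graphs with a cemetery vertex -/

section FiniteGraph

variable {W : Type*} [Fintype W]

/-- `δ` is a cemetery vertex: no edge exits `δ`, and every vertex is connected to `δ`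
through a directed path. -/
def IsCemetery (G : Digraph W) (δ : W) : Prop :=
  (∀ y, ¬ G.Adj δ y) ∧ ∀ x, Relation.ReflTransGen G.Adj x δ

/-- The heads of the edges that exit `x`; as there are no multiple edges, they stand for
the edges themselves. -/
abbrev Out (G : Digraph W) (x : W) : Type _ := {y : W // G.Adj x y}

open scoped Classical in
/-- Environments: at each vertex other than `δ`, positive exit probabilities along the edges
that exit the vertex, with sum `1`. -/
abbrev Env (G : Digraph W) (δ : W) : Type _ :=
  (x : {x : W // x ≠ δ}) → Simplex (Out G x.1)

open scoped Classical in
/-- The law of the Dirichlet environment with weights `α`: the exit probabilities at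
different vertices are independent, with Dirichlet laws. Only the weights of edges matter. -/
def envLaw (G : Digraph W) (δ : W) (α : W → W → ℝ) : Measure (Env G δ) :=
  Measure.pi fun x => dirichlet fun y : Out G x.1 => α x.1 y.1

open scoped Classical in
/-- The exit distribution given by a point of the simplex over the edges exiting `x`. -/
def exitPMF {G : Digraph W} {x : W} (p : Simplex (Out G x)) : PMF (Out G x) :=
  PMF.ofFintype (fun y => ENNReal.ofReal (p.1 y)) (by
    rw [← ENNReal.ofReal_sum_of_nonneg fun y _ => (p.2.1 y).le, p.2.2, ENNReal.ofReal_one])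

open scoped Classical in
/-- One step of the walk in the environment `ω`; the walk stays at `δ` once it is there. -/
def step {G : Digraph W} {δ : W} (ω : Env G δ) (x : W) : PMF W :=
  if h : x = δ then PMF.pure δ else (exitPMF (ω ⟨x, h⟩)).map Subtype.val

variable [MeasurableSpace W] [DiscreteMeasurableSpace W]

/-- The transition kernel of the walk in the environment `ω`. -/
def stepKernel {G : Digraph W} {δ : W} (ω : Env G δ) : Kernel W W :=
  Kernel.ofFunOfCountable fun x => (step ω x).toMeasure

instance {G : Digraph W} {δ : W} (ω : Env G δ) : IsMarkovKernel (stepKernel ω) :=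
  ⟨fun x => inferInstanceAs (IsProbabilityMeasure (step ω x).toMeasure)⟩

/-- The conditional law of `Z (n + 1)` given `Z 0, …, Z n`: a step from `Z n`. -/
def nextKernel {G : Digraph W} {δ : W} (ω : Env G δ) (n : ℕ) :
    Kernel (Finset.Iic n → W) W :=
  (stepKernel ω).comap (fun z => z ⟨n, Finset.mem_Iic.2 le_rfl⟩) (measurable_pi_apply _)

instance {G : Digraph W} {δ : W} (ω : Env G δ) (n : ℕ) : IsMarkovKernel (nextKernel ω n) :=
  inferInstanceAs (IsMarkovKernel ((stepKernel ω).comap _ _))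

/-- The quenched law `P_x^ω` on trajectories `(Z n)` of the walk started at `x`. -/
def walkLaw {G : Digraph W} {δ : W} (ω : Env G δ) (x : W) : Measure (ℕ → W) :=
  Kernel.traj (X := fun _ => W) (nextKernel ω) 0 fun _ => x

/-- The hitting time `H_y = inf {n ≥ 0 : Z n = y}`. -/
def hitTime (y : W) (Z : ℕ → W) : ℕ∞ := ⨅ (n : ℕ) (_ : Z n = y), (n : ℕ∞)

/-- The return time `inf {n ≥ 1 : Z n = y}`. -/
def returnTime (y : W) (Z : ℕ → W) : ℕ∞ := ⨅ (n : ℕ) (_ : 1 ≤ n ∧ Z n = y), (n : ℕ∞)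

/-- The time of the first loop `L = inf {n ≥ 1 : Z n = Z m for some m < n}`. -/
def loopTime (Z : ℕ → W) : ℕ∞ :=
  ⨅ (n : ℕ) (_ : 1 ≤ n ∧ ∃ m < n, Z n = Z m), (n : ℕ∞)

/-- `γ^ω(x)`, the inverse of the `P_x^ω`-probability to reach `δ` before returning to `x` and
before the first loop. -/
def gamma {G : Digraph W} {δ : W} (ω : Env G δ) (x : W) : ℝ≥0∞ :=
  (walkLaw ω x {Z | hitTime δ Z < min (returnTime x Z) (loopTime Z)})⁻¹

end FiniteGraph

section ExitSums

variable {W : Type*} [Fintype W]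

/-- The tails of the edges in `A`. -/
def tails (A : Set (W × W)) : Set W := Prod.fst '' A

/-- The heads of the edges in `A`. -/
def heads (A : Set (W × W)) : Set W := Prod.snd '' A

/-- `A` is a strongly connected set of edges of `G`: any two endpoints of edges in `A` are
joined by a directed path in `A`. -/
def IsStronglyConnected (G : Digraph W) (A : Set (W × W)) : Prop :=
  (∀ e ∈ A, G.Adj e.1 e.2) ∧
    ∀ x ∈ heads A ∪ tails A, ∀ y ∈ heads A ∪ tails A,
      Relation.ReflTransGen (fun a b => (a, b) ∈ A) x y

open scoped Classical in
/-- `β_A`, the sum of the weights of the edges that exit the vertex set of `A`. -/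
def exitSum (G : Digraph W) (α : W → W → ℝ) (A : Set (W × W)) : ℝ :=
  ∑ e : W × W with G.Adj e.1 e.2 ∧ e.1 ∈ tails A ∧ e.2 ∉ tails A, α e.1 e.2

/-- The numbers `β_A`, for the strongly connected sets `A` of edges that contain `o`. -/
def exitSums (G : Digraph W) (α : W → W → ℝ) (o : W) : Set ℝ :=
  {b | ∃ A : Set (W × W), IsStronglyConnected G A ∧ o ∈ tails A ∧ b = exitSum G α A}

end ExitSums

/-! ### The lattice `ℤ^d` -/

/-- The `2d` directions: `Sum.inl i` stands for `e_i` and `Sum.inr i` for `e_{i+d} = -e_i`. -/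
abbrev Dir (d : ℕ) : Type := Fin d ⊕ Fin d

/-- The unit vector of a direction. -/
def unitVec {d : ℕ} : Dir d → (Fin d → ℤ)
  | Sum.inl i => Pi.single i 1
  | Sum.inr i => -Pi.single i 1

/-- Environments on `ℤ^d`; `(ω x).1 i` is the probability to jump from `x` to `x + e_i`. -/
abbrev LatticeEnv (d : ℕ) : Type := (Fin d → ℤ) → Simplex (Dir d)

/-- The law of the i.i.d. Dirichlet environment on `ℤ^d` with parameters `α`. -/
def latticeLaw {d : ℕ} (α : Dir d → ℝ) : Measure (LatticeEnv d) :=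
  Measure.infinitePi fun _ => dirichlet α

/-- The set `Λ` of vertices of `ℤ^d` is connected. -/
def IsConnectedSet {d : ℕ} (Λ : Finset (Fin d → ℤ)) : Prop :=
  ∀ x ∈ Λ, ∀ y ∈ Λ,
    Relation.ReflTransGen (fun a b => b ∈ Λ ∧ ∃ i : Dir d, b = a + unitVec i) x y

/-- The vertices visited after the start by the path from `x` with the given steps. -/
def trail {d : ℕ} : (Fin d → ℤ) → List (Dir d) → List (Fin d → ℤ)
  | _, [] => []
  | x, i :: σ => (x + unitVec i) :: trail (x + unitVec i) σ

/-- `ω_σ`, the product of the `ω(e)` along the edges of the path from `x` with the given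
steps. -/
def pathWeight {d : ℕ} (ω : LatticeEnv d) : (Fin d → ℤ) → List (Dir d) → ℝ
  | _, [] => 1
  | x, i :: σ => (ω x).1 i * pathWeight ω (x + unitVec i) σ

/-- The path from `x` with steps `σ` is simple, and it stops just after exiting `x + Λ`. -/
def IsExitPath {d : ℕ} (Λ : Finset (Fin d → ℤ)) (x : Fin d → ℤ) (σ : List (Dir d)) : Prop :=
  (x :: trail x σ).Nodup ∧
    (∀ y ∈ (x :: trail x σ).dropLast, y - x ∈ Λ) ∧
    (x :: trail x σ).getLast (List.cons_ne_nil _ _) - x ∉ Λ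

/-- The accelerating function on `ℤ^d`: the inverse of the sum of `ω_σ` over the simple paths
`σ` from `x` stopped just after exiting `x + Λ`. -/
def latticeGamma {d : ℕ} (Λ : Finset (Fin d → ℤ)) (ω : LatticeEnv d) (x : Fin d → ℤ) : ℝ≥0∞ :=
  (∑' σ : {σ : List (Dir d) // IsExitPath Λ x σ}, ENNReal.ofReal (pathWeight ω x σ.1))⁻¹

/-- `κ = 2 ∑_{i ≤ 2d} α_i - max_{i ≤ d} (α_i + α_{i+d})`. -/
def kappa {d : ℕ} (α : Dir d → ℝ) : ℝ :=
  2 * ∑ i, α i - ⨆ i : Fin d, (α (Sum.inl i) + α (Sum.inr i))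

end RWDE

end

namespace RWDE

/-! ### The Dirichlet integral -/

/-! Give each edge the length `-log ω(e)` and let `U r` be the set of vertices reachable from the
starting point at cost at most `r`. A simple path of cost `c` to the cemetery forces `γ ≤ exp c`, so
on `γ > t` the ball `U r` misses the cemetery for all `r < log t`. Some exit probability at the
starting point is at least the inverse of the number of exits, so from a constant radius on the ball
contains a neighbour. It is then the vertex set of a strongly connected set of edges, and the
weights of the edges leaving it sum to at least `β`.

An edge leaves `U r` only for `r` in a set of diameter at most its length. Integrating the cut bound
over `r` (`mul_le_sum_of_forall_le_cut`) thus gives `β (log t - const) ≤ ∑ α(e) (-log ω(e))`, that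
is, `∏ ω(e) ^ (-α(e)) ≥ const * t ^ β`.

That product is not integrable, but the explicit Dirichlet moments show that exponents `ε - α(e)`
give a mean of order at most `ε ^ (-m)`, with `m` the number of edges
(`exists_lintegral_envLaw_le`). Markov's inequality with `ε = 1 / log t` loses a constant factor in
the power of `t` and a power of `log t`.

On the lattice the cut bound is an edge isoperimetric inequality (`kappa_le_sum_boundary`). For `s <
κ` a small fixed `ε` leaves room, and `γ ^ s` is dominated by a product over independent sites with
finite mean. -/

/-- The integrand of the Gamma function, extended by zero. -/
noncomputable def gammaIntegrand (a x : ℝ) : ℝ :=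
  (Set.Ioi (0 : ℝ)).indicator (fun x => Real.exp (-x) * x ^ (a - 1)) x

lemma gammaIntegrand_nonneg (a x : ℝ) : 0 ≤ gammaIntegrand a x := by
  refine Set.indicator_nonneg (fun x hx => ?_) x
  have : 0 < x := hx
  positivity

lemma gammaIntegrand_of_pos (a : ℝ) {x : ℝ} (hx : 0 < x) :
    gammaIntegrand a x = Real.exp (-x) * x ^ (a - 1) :=
  Set.indicator_of_mem (s := Set.Ioi (0 : ℝ)) hx _

lemma gammaIntegrand_of_nonpos (a : ℝ) {x : ℝ} (hx : x ≤ 0) : gammaIntegrand a x = 0 :=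
  Set.indicator_of_notMem (s := Set.Ioi (0 : ℝ)) (by simpa using hx) _

lemma measurable_gammaIntegrand (a : ℝ) : Measurable (gammaIntegrand a) := by
  refine Measurable.indicator ?_ measurableSet_Ioi
  fun_prop

lemma integrable_gammaIntegrand {a : ℝ} (ha : 0 < a) : Integrable (gammaIntegrand a) := by
  have h := Real.GammaIntegral_convergent ha
  exact (integrable_indicator_iff measurableSet_Ioi).2 h

lemma integral_gammaIntegrand {a : ℝ} (ha : 0 < a) : ∫ x, gammaIntegrand a x = Real.Gamma a := by
  rw [Real.Gamma_eq_integral ha]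
  exact integral_indicator measurableSet_Ioi

lemma lintegral_gammaIntegrand {a : ℝ} (ha : 0 < a) :
    ∫⁻ x, ENNReal.ofReal (gammaIntegrand a x) = ENNReal.ofReal (Real.Gamma a) := by
  rw [← integral_gammaIntegrand ha, ofReal_integral_eq_lintegral_ofReal
    (integrable_gammaIntegrand ha) (Eventually.of_forall fun x => gammaIntegrand_nonneg a x)]

lemma lintegral_prod_gammaIntegrand {ι : Type*} [Fintype ι] {a : ι → ℝ} (ha : ∀ i, 0 < a i) :
    ∫⁻ y : ι → ℝ, ENNReal.ofReal (∏ i, gammaIntegrand (a i) (y i)) =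
      ENNReal.ofReal (∏ i, Real.Gamma (a i)) := by
  rw [← ofReal_integral_eq_lintegral_ofReal]
  · rw [integral_fintype_prod_volume_eq_prod (fun i => gammaIntegrand (a i))]
    simp_rw [fun i => integral_gammaIntegrand (ha i)]
  · exact Integrable.fintype_prod_dep (μ := fun _ => volume)
      (fun i => integrable_gammaIntegrand (ha i))
  · exact Eventually.of_forall fun y => Finset.prod_nonneg fun i _ => gammaIntegrand_nonneg _ _

/-! ### Integration over the simplex in a chart. -/

section Completion

variable {ι : Type*} [Fintype ι]

open scoped Classical in
/-- The vector with coordinates `x` off `i₀` whose sum is `s`. -/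
noncomputable def completeTo (i₀ : ι) (s : ℝ) (x : {i : ι // i ≠ i₀} → ℝ) : ι → ℝ :=
  fun i => if h : i = i₀ then s - ∑ j, x j else x ⟨i, h⟩

open scoped Classical in
lemma sum_completeTo (i₀ : ι) (s : ℝ) (x : {i : ι // i ≠ i₀} → ℝ) :
    ∑ i, completeTo i₀ s x i = s := by
  have h : ∑ i : {i : ι // i ≠ i₀}, completeTo i₀ s x i = ∑ j, x j :=
    Finset.sum_congr rfl fun j _ => by simp [completeTo, j.2]
  rw [Fintype.sum_eq_add_sum_subtype_ne _ i₀, h]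
  simp [completeTo]

open scoped Classical in
lemma completeTo_smul (i₀ : ι) (s : ℝ) (x : {i : ι // i ≠ i₀} → ℝ) :
    completeTo i₀ s (s • x) = s • complete i₀ x := by
  ext i
  by_cases h : i = i₀
  · simp [completeTo, complete, h, mul_sub, Finset.mul_sum]
  · simp [completeTo, complete, h]

open scoped Classical in
lemma measurable_completeTo (i₀ : ι) :
    Measurable fun p : ℝ × ({i : ι // i ≠ i₀} → ℝ) => completeTo i₀ p.1 p.2 := by
  refine measurable_pi_lambda _ fun i => ?_
  by_cases h : i = i₀
  · simp only [completeTo, h, dite_true]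
    fun_prop
  · simp only [completeTo, h, dite_false]
    fun_prop

lemma measurable_complete (i₀ : ι) : Measurable (complete i₀) :=
  (measurable_completeTo i₀).comp (measurable_const.prodMk measurable_id)

open scoped Classical in
/-- Lebesgue measure disintegrated along the sum of the coordinates. -/
lemma lintegral_eq_lintegral_completeTo (i₀ : ι) {f : (ι → ℝ) → ℝ≥0∞} (hf : Measurable f) :
    ∫⁻ y, f y = ∫⁻ s : ℝ, ∫⁻ x : {i : ι // i ≠ i₀} → ℝ, f (completeTo i₀ s x) := by
  have hu : Unique {i : ι // ¬ i ≠ i₀} :=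
    ⟨⟨⟨i₀, by simp⟩⟩, fun j => Subtype.ext (not_not.1 j.2)⟩
  have h1 := (volume_preserving_piEquivPiSubtypeProd (fun _ : ι => ℝ) (fun i => i ≠ i₀)).symm
  have h2 : MeasurePreserving (MeasurableEquiv.funUnique {i : ι // ¬ i ≠ i₀} ℝ).symm
      volume (Measure.pi fun _ => volume) := by
    convert! (volume_preserving_funUnique {i : ι // ¬ i ≠ i₀} ℝ).symm
    change _ = @Measure.pi _ _ Unique.fintype _ _
    congr!
  have hm : Measurable fun p : ({i : ι // i ≠ i₀} → ℝ) × ({i : ι // ¬ i ≠ i₀} → ℝ) =>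
      f ((MeasurableEquiv.piEquivPiSubtypeProd (fun _ : ι => ℝ) (fun i => i ≠ i₀)).symm p) :=
    hf.comp (MeasurableEquiv.measurable _)
  rw [← h1.lintegral_comp hf, Measure.volume_eq_prod, lintegral_prod _ hm.aemeasurable,
    lintegral_lintegral_swap (f := fun s x => f (completeTo i₀ s x))
      (hf.comp (measurable_completeTo i₀)).aemeasurable]
  refine lintegral_congr fun x => ?_
  have hmx : Measurable fun y : {i : ι // ¬ i ≠ i₀} → ℝ =>
      f ((MeasurableEquiv.piEquivPiSubtypeProd (fun _ : ι => ℝ) (fun i => i ≠ i₀)).symm (x, y)) :=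
    hm.comp measurable_prodMk_left
  -- Translating the eliminated coordinate by `∑ j, x j` makes the integration variable the total
  -- sum.
  rw [volume_pi, ← h2.lintegral_comp hmx, ← lintegral_sub_right_eq_self _ (∑ j, x j)]
  refine lintegral_congr fun s => congrArg f (funext fun i => ?_)
  by_cases h : i = i₀
  · subst h
    simp [completeTo, MeasurableEquiv.piEquivPiSubtypeProd, Equiv.piEquivPiSubtypeProd]
  · simp [completeTo, MeasurableEquiv.piEquivPiSubtypeProd, Equiv.piEquivPiSubtypeProd, h]

lemma measurableSet_openSimplex (ι : Type*) [Fintype ι] : MeasurableSet (openSimplex ι) := by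
  have h : openSimplex ι = (⋂ i, {x : ι → ℝ | 0 < x i}) ∩ {x | ∑ i, x i = 1} := by
    ext x
    simp [openSimplex]
  rw [h]
  refine MeasurableSet.inter ?_ ?_
  · exact MeasurableSet.iInter fun i => measurableSet_lt measurable_const (measurable_pi_apply i)
  · exact measurableSet_eq_fun (by fun_prop) measurable_const

lemma lintegral_eq_pow_mul_lintegral_smul {κ : Type*} [Fintype κ] {s : ℝ} (hs : 0 < s)
    {F : (κ → ℝ) → ℝ≥0∞} (hF : Measurable F) :
    ∫⁻ z, F z = ENNReal.ofReal (s ^ Fintype.card κ) * ∫⁻ x, F (s • x) := by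
  have h := Measure.map_addHaar_smul (volume : Measure (κ → ℝ)) hs.ne'
  have h2 : ∫⁻ x, F (s • x) = ENNReal.ofReal (s ^ Fintype.card κ)⁻¹ * ∫⁻ z, F z := by
    rw [← lintegral_map hF (measurable_const_smul s), h, lintegral_smul_measure, smul_eq_mul,
      Module.finrank_fintype_fun_eq_card, abs_of_pos (by positivity)]
  rw [h2, ← mul_assoc, ← ENNReal.ofReal_mul (by positivity), mul_inv_cancel₀ (by positivity),
    ENNReal.ofReal_one, one_mul]

open scoped Classical in
/-- The Dirichlet integral, in the chart that eliminates the coordinate `i₀`. -/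
lemma lintegral_complete_prod_rpow (i₀ : ι) {a : ι → ℝ} (ha : ∀ i, 0 < a i) :
    ENNReal.ofReal (Real.Gamma (∑ i, a i)) *
      ∫⁻ x, (openSimplex ι).indicator
        (fun y => ENNReal.ofReal (∏ i, y i ^ (a i - 1))) (complete i₀ x) =
      ENNReal.ofReal (∏ i, Real.Gamma (a i)) := by
  have hsum : 0 < ∑ i, a i := Finset.sum_pos (fun i _ => ha i) ⟨i₀, Finset.mem_univ _⟩
  have hf : Measurable fun y : ι → ℝ => ENNReal.ofReal (∏ i, gammaIntegrand (a i) (y i)) := by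
    refine (Finset.measurable_prod _ fun i _ => ?_).ennreal_ofReal
    exact (measurable_gammaIntegrand _).comp (measurable_pi_apply i)
  -- The integral of the product of Gamma integrands is computed in two ways: by Fubini, and by
  -- slicing along the sum `s` and rescaling each slice to the unit simplex. The factor depending on
  -- `s` integrates to `Γ(∑ a)`.
  rw [← lintegral_prod_gammaIntegrand ha, lintegral_eq_lintegral_completeTo i₀ hf,
    ← lintegral_gammaIntegrand hsum,
    ← lintegral_mul_const _ (measurable_gammaIntegrand _).ennreal_ofReal]
  refine lintegral_congr fun s => ?_
  rcases le_or_gt s 0 with hs | hs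
  · rw [gammaIntegrand_of_nonpos _ hs, ENNReal.ofReal_zero, zero_mul, eq_comm]
    refine (lintegral_congr fun x => ?_).trans lintegral_zero
    obtain ⟨i, -, hi⟩ : ∃ i ∈ Finset.univ, completeTo i₀ s x i ≤ 0 := by
      by_contra! h
      have := Finset.sum_pos h ⟨i₀, Finset.mem_univ _⟩
      rw [sum_completeTo] at this
      linarith
    rw [Finset.prod_eq_zero (Finset.mem_univ i) (gammaIntegrand_of_nonpos _ hi),
      ENNReal.ofReal_zero]
  · have hD : Measurable fun x => (openSimplex ι).indicator
        (fun y => ENNReal.ofReal (∏ i, y i ^ (a i - 1))) (complete i₀ x) := by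
      refine Measurable.comp (Measurable.indicator ?_ (measurableSet_openSimplex ι))
        (measurable_complete i₀)
      exact (Finset.measurable_prod _ fun i _ => by fun_prop).ennreal_ofReal
    have hF : Measurable fun x => ENNReal.ofReal
        (∏ i, gammaIntegrand (a i) (completeTo i₀ s x i)) :=
      hf.comp ((measurable_completeTo i₀).comp (measurable_const.prodMk measurable_id))
    rw [lintegral_eq_pow_mul_lintegral_smul hs hF, ← lintegral_const_mul _ hD,
      ← lintegral_const_mul']
    · refine lintegral_congr fun x => ?_
      simp only [completeTo_smul]
      by_cases hx : complete i₀ x ∈ openSimplex ι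
      · rw [Set.indicator_of_mem hx, ← ENNReal.ofReal_mul (gammaIntegrand_nonneg _ _),
          ← ENNReal.ofReal_mul (by positivity), gammaIntegrand_of_pos _ hs]
        congr 1
        -- The exponent of `s`: the Jacobian of the rescaling contributes the number of free
        -- coordinates, and each integrand contributes `a i - 1`.
        have hcard : (Fintype.card {i : ι // i ≠ i₀} : ℝ) + ∑ i, (a i - 1) = ∑ i, a i - 1 := by
          have h1 : Fintype.card {i : ι // i ≠ i₀} = Fintype.card ι - 1 := by
            rw [Fintype.card_subtype_compl, Fintype.card_subtype_eq]
          have h2 : 1 ≤ Fintype.card ι := Fintype.card_pos_iff.2 ⟨i₀⟩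
          rw [h1, Finset.sum_sub_distrib]
          push_cast [h2]
          simp
        have hprod : ∏ i, gammaIntegrand (a i) ((s • complete i₀ x) i) =
            Real.exp (-s) * s ^ (∑ i, (a i - 1)) * ∏ i, complete i₀ x i ^ (a i - 1) := by
          have h1 : ∀ i, gammaIntegrand (a i) ((s • complete i₀ x) i) =
              Real.exp (-s * complete i₀ x i) * (s ^ (a i - 1) * complete i₀ x i ^ (a i - 1)) := by
            intro i
            have := hx.1 i
            rw [Pi.smul_apply, smul_eq_mul, gammaIntegrand_of_pos _ (mul_pos hs this),
              Real.mul_rpow hs.le this.le, neg_mul]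
          simp_rw [h1, Finset.prod_mul_distrib, ← Real.exp_sum, ← Finset.mul_sum, hx.2,
            Real.rpow_sum_of_pos hs]
          ring_nf
        rw [hprod, ← hcard, Real.rpow_add hs, Real.rpow_natCast]
        ring
      · rw [Set.indicator_of_notMem hx, mul_zero]
        obtain ⟨i, hi⟩ : ∃ i, complete i₀ x i ≤ 0 := by
          by_contra! h
          exact hx ⟨h, sum_completeTo i₀ 1 x⟩
        rw [Finset.prod_eq_zero (Finset.mem_univ i), ENNReal.ofReal_zero, mul_zero]
        exact gammaIntegrand_of_nonpos _ (mul_nonpos_of_nonneg_of_nonpos hs.le hi)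
    · exact ENNReal.ofReal_ne_top

end Completion

/-! ### Moments of the Dirichlet law. -/

section Dirichlet

variable {ι : Type*} [Fintype ι] [Nonempty ι]

/-- The moments of the Dirichlet law. -/
lemma lintegral_dirichlet_prod_rpow {a b : ι → ℝ} (ha : ∀ i, 0 < a i) (hb : ∀ i, 0 < b i) :
    ∫⁻ p, ENNReal.ofReal (∏ i, p.1 i ^ (b i - a i)) ∂(dirichlet a) =
      ENNReal.ofReal (Real.Gamma (∑ i, a i) / (∏ i, Real.Gamma (a i)) *
        ((∏ i, Real.Gamma (b i)) / Real.Gamma (∑ i, b i))) := by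
  classical
  have hsa : 0 < Real.Gamma (∑ i, a i) :=
    Real.Gamma_pos_of_pos (Finset.sum_pos (fun i _ => ha i) Finset.univ_nonempty)
  have hsb : 0 < Real.Gamma (∑ i, b i) :=
    Real.Gamma_pos_of_pos (Finset.sum_pos (fun i _ => hb i) Finset.univ_nonempty)
  have hpa : 0 < ∏ i, Real.Gamma (a i) :=
    Finset.prod_pos fun i _ => Real.Gamma_pos_of_pos (ha i)
  have hpow : ∀ c : ι → ℝ, Measurable fun y : ι → ℝ => ENNReal.ofReal (∏ i, y i ^ c i) :=
    fun c => (Finset.measurable_prod _ fun i _ => by fun_prop).ennreal_ofReal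
  have hdens : Measurable (dirichletDensity a) := by
    refine Measurable.ennreal_ofReal (Measurable.const_mul ?_ _)
    exact Finset.measurable_prod _ fun i _ =>
      ((measurable_pi_apply i).comp measurable_subtype_coe).pow_const _
  set i₀ : ι := Nonempty.some (inferInstanceAs (Nonempty ι)) with hi₀
  set K : ℝ := Real.Gamma (∑ i, a i) / ∏ i, Real.Gamma (a i) with hK
  have hK0 : 0 < K := div_pos hsa hpa
  have hb' : Measurable fun p : Simplex ι => ENNReal.ofReal (∏ i, p.1 i ^ (b i - a i)) :=
    (hpow _).comp measurable_subtype_coe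
  rw [dirichlet, dif_pos (inferInstanceAs (Nonempty ι)),
    lintegral_withDensity_eq_lintegral_mul _ hdens hb']
  -- The density changes the exponents `b i - a i` into `b i - 1`, which leaves the Dirichlet
  -- integral with parameters `b`.
  have h1 : ∀ p : Simplex ι, (dirichletDensity a * fun p : Simplex ι =>
      ENNReal.ofReal (∏ i, p.1 i ^ (b i - a i))) p =
      ENNReal.ofReal K * ENNReal.ofReal (∏ i, p.1 i ^ (b i - 1)) := by
    intro p
    rw [Pi.mul_apply, dirichletDensity, ← ENNReal.ofReal_mul, ← ENNReal.ofReal_mul hK0.le,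
      mul_assoc, ← Finset.prod_mul_distrib]
    · congr 3 with i
      rw [← Real.rpow_add (p.2.1 i)]
      ring_nf
    · have := Finset.prod_nonneg fun i (_ : i ∈ Finset.univ) =>
        Real.rpow_nonneg (p.2.1 i).le (a i - 1)
      positivity
  have h2 := lintegral_complete_prod_rpow i₀ hb
  rw [← ENNReal.eq_div_iff (by simpa using hsb) ENNReal.ofReal_ne_top,
    ← ENNReal.ofReal_div_of_pos hsb] at h2
  rw [lintegral_congr h1, lintegral_const_mul' _ _ ENNReal.ofReal_ne_top, simplexMeasure,
    lintegral_subtype_comap (measurableSet_openSimplex ι)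
      (fun y => ENNReal.ofReal (∏ i, y i ^ (b i - 1))),
    ← lintegral_indicator (measurableSet_openSimplex ι),
    lintegral_map ((hpow _).indicator (measurableSet_openSimplex ι)) (measurable_complete _),
    h2, ENNReal.ofReal_mul hK0.le]

/-- This is the moment formula at `b = a`, where the integrand is `1`. -/
lemma isProbabilityMeasure_dirichlet {a : ι → ℝ} (ha : ∀ i, 0 < a i) :
    IsProbabilityMeasure (dirichlet a) := by
  have h := lintegral_dirichlet_prod_rpow ha ha
  have hsa : 0 < Real.Gamma (∑ i, a i) :=
    Real.Gamma_pos_of_pos (Finset.sum_pos (fun i _ => ha i) Finset.univ_nonempty)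
  have hpa : 0 < ∏ i, Real.Gamma (a i) :=
    Finset.prod_pos fun i _ => Real.Gamma_pos_of_pos (ha i)
  rw [div_mul_div_cancel₀ hpa.ne', div_self hsa.ne'] at h
  exact ⟨by simpa using h⟩

end Dirichlet

/-- Through `Γ(x) = Γ(x + 1) / x`, bounds on a compact interval starting at `1` control `Γ` near its
pole at `0`. -/
lemma exists_bounds_Gamma (b : ℝ) : ∃ m M : ℝ, 0 < m ∧ 0 < M ∧
    ∀ x ∈ Set.Icc 1 b, m ≤ Real.Gamma x ∧ Real.Gamma x ≤ M := by
  rcases lt_or_ge b 1 with hb | hb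
  · exact ⟨1, 1, one_pos, one_pos, fun x hx => absurd (hx.1.trans hx.2) (not_le.2 hb)⟩
  have hpos : ∀ x ∈ Set.Icc 1 b, 0 < Real.Gamma x := fun x hx =>
    Real.Gamma_pos_of_pos (one_pos.trans_le hx.1)
  have hc : ContinuousOn Real.Gamma (Set.Icc 1 b) := fun x hx =>
    (Real.differentiableAt_Gamma fun m => by
      have h1 : (0 : ℝ) ≤ m := m.cast_nonneg
      linarith [hx.1]).continuousAt.continuousWithinAt
  have hne : (Set.Icc 1 b).Nonempty := ⟨1, le_rfl, hb⟩
  obtain ⟨x, hx, hxm⟩ := isCompact_Icc.exists_isMinOn hne hc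
  obtain ⟨y, hy, hyM⟩ := isCompact_Icc.exists_isMaxOn hne hc
  exact ⟨_, _, hpos x hx, hpos y hy, fun z hz => ⟨hxm hz, hyM hz⟩⟩

/-- The negative moments of the Dirichlet law blow up at most polynomially when the exponents
approach the critical ones. -/
lemma exists_lintegral_dirichlet_le {ι : Type*} [Fintype ι] [Nonempty ι] {a : ι → ℝ}
    (ha : ∀ i, 0 < a i) : ∃ C : ℝ, 0 < C ∧ ∀ ε ∈ Set.Ioc (0 : ℝ) 1,
      ∫⁻ p, ENNReal.ofReal (∏ i, p.1 i ^ (ε - a i)) ∂(dirichlet a) ≤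
        ENNReal.ofReal (C * ε⁻¹ ^ Fintype.card ι) := by
  -- The interval contains `ε + 1` and `n * ε + 1` for `ε ≤ 1`, with `n` the number of coordinates.
  -- With all parameters `b i = ε`, the moment is a constant times `Γ(ε) ^ n / Γ(n ε)`.
  obtain ⟨m, M, hm, hM, h⟩ := exists_bounds_Gamma (Fintype.card ι + 1)
  have hn : (1 : ℝ) ≤ Fintype.card ι := by exact_mod_cast Fintype.card_pos
  have hsa : 0 < Real.Gamma (∑ i, a i) :=
    Real.Gamma_pos_of_pos (Finset.sum_pos (fun i _ => ha i) Finset.univ_nonempty)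
  have hpa : 0 < ∏ i, Real.Gamma (a i) :=
    Finset.prod_pos fun i _ => Real.Gamma_pos_of_pos (ha i)
  refine ⟨Real.Gamma (∑ i, a i) / (∏ i, Real.Gamma (a i)) *
    (M ^ Fintype.card ι * (Fintype.card ι / m)), by positivity, fun ε hε => ?_⟩
  obtain ⟨hε0, hε1⟩ := hε
  rw [lintegral_dirichlet_prod_rpow ha fun _ => hε0]
  refine ENNReal.ofReal_le_ofReal ?_
  rw [mul_assoc]
  refine mul_le_mul_of_nonneg_left ?_ (by positivity)
  simp only [Finset.prod_const, Finset.sum_const, Finset.card_univ, nsmul_eq_mul]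
  set n : ℝ := (Fintype.card ι : ℝ) with hndef
  have h1 : Real.Gamma ε ≤ M * ε⁻¹ := by
    have h2 := (h (ε + 1) ⟨by linarith, by linarith⟩).2
    rw [Real.Gamma_add_one hε0.ne'] at h2
    rw [← div_eq_mul_inv, le_div_iff₀ hε0]
    linarith
  have h3 : (Real.Gamma (n * ε))⁻¹ ≤ n / m := by
    have hne : 0 < n * ε := by positivity
    have h2 := (h (n * ε + 1) ⟨by linarith, by nlinarith⟩).1
    rw [Real.Gamma_add_one hne.ne'] at h2
    have hG := Real.Gamma_pos_of_pos hne
    rw [inv_le_iff_one_le_mul₀ hG, div_mul_eq_mul_div, one_le_div hm]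
    refine h2.trans (mul_le_mul_of_nonneg_right ?_ hG.le)
    nlinarith
  have hG : 0 < Real.Gamma ε := Real.Gamma_pos_of_pos hε0
  calc Real.Gamma ε ^ Fintype.card ι / Real.Gamma (n * ε)
      ≤ (M * ε⁻¹) ^ Fintype.card ι * (n / m) := by
        rw [div_eq_mul_inv]
        refine mul_le_mul (pow_le_pow_left₀ hG.le h1 _) h3 ?_ (by positivity)
        exact inv_nonneg.2 (Real.Gamma_pos_of_pos (by positivity)).le
    _ = M ^ Fintype.card ι * (n / m) * ε⁻¹ ^ Fintype.card ι := by
        rw [mul_pow]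
        ring

/-! ### Cuts and distances -/

open scoped Classical in
/-- If `U r` is an increasing family of vertex sets such that an edge `e` with tail in `U r` has
its head in `U (r + u e)`, and if the weights of the edges that exit `U r` sum to at least `s`
for `c ≤ r < T`, then `s * (T - c)` is at most the total weighted length of the edges. -/
lemma mul_le_sum_of_forall_le_cut {E W : Type*} [Fintype E] {src tgt : E → W} {a u : E → ℝ}
    (ha : ∀ e, 0 ≤ a e) (hu : ∀ e, 0 ≤ u e) {U : ℝ → Set W} (hU : Monotone U)
    (hstep : ∀ e r, src e ∈ U r → tgt e ∈ U (r + u e)) {s c T : ℝ} (hT : c ≤ T)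
    (hcut : ∀ r, c ≤ r → r < T → s ≤ ∑ e with src e ∈ U r ∧ tgt e ∉ U r, a e) :
    s * (T - c) ≤ ∑ e, a e * u e := by
  have hnn : 0 ≤ ∑ e, a e * u e := Finset.sum_nonneg fun e _ => mul_nonneg (ha e) (hu e)
  rcases lt_or_ge s 0 with hs | hs
  · nlinarith
  -- `B e` is the set of radii at which `e` crosses the boundary. By `hstep` its diameter is at most
  -- `u e`, so integrating the cut weight over `r` counts `a e` with mass at most `u e`.
  let B : E → Set ℝ := fun e => {r | src e ∈ U r ∧ tgt e ∉ U r}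
  have hB : ∀ e, MeasurableSet (B e) := by
    intro e
    have h1 : MeasurableSet {r | src e ∈ U r} :=
      (IsUpperSet.ordConnected fun r r' h hr => hU h hr).measurableSet
    have h2 : MeasurableSet {r | tgt e ∈ U r} :=
      (IsUpperSet.ordConnected fun r r' h hr => hU h hr).measurableSet
    exact h1.inter h2.compl
  have hvol : ∀ e, volume (B e) ≤ ENNReal.ofReal (u e) := by
    intro e
    refine (Real.volume_le_diam _).trans (Metric.ediam_le fun r hr r' hr' => ?_)
    rw [edist_dist]
    refine ENNReal.ofReal_le_ofReal ?_
    have key : ∀ r ∈ B e, ∀ r' ∈ B e, r' - r ≤ u e := by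
      intro r hr r' hr'
      by_contra! h
      exact hr'.2 (hU (by linarith) (hstep e r hr.1))
    rw [Real.dist_eq, abs_le]
    constructor
    · linarith [key r hr r' hr']
    · linarith [key r' hr' r hr]
  have h1 : ENNReal.ofReal (s * (T - c)) ≤ ENNReal.ofReal (∑ e, a e * u e) :=
    calc ENNReal.ofReal (s * (T - c)) = ∫⁻ _ in Set.Ico c T, ENNReal.ofReal s := by
          rw [setLIntegral_const, Real.volume_Ico, ENNReal.ofReal_mul hs]
      _ ≤ ∫⁻ r in Set.Ico c T, ∑ e, (B e).indicator (fun _ => ENNReal.ofReal (a e)) r := by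
          refine setLIntegral_mono' measurableSet_Ico fun r hr => ?_
          refine (ENNReal.ofReal_le_ofReal (hcut r hr.1 hr.2)).trans ?_
          rw [ENNReal.ofReal_sum_of_nonneg fun e _ => ha e, Finset.sum_filter]
          exact Finset.sum_le_sum fun e _ => by
            by_cases h : src e ∈ U r ∧ tgt e ∉ U r
            · rw [if_pos h, Set.indicator_of_mem (s := B e) h]
            · rw [if_neg h]
              exact zero_le
      _ ≤ ∫⁻ r, ∑ e, (B e).indicator (fun _ => ENNReal.ofReal (a e)) r :=
          setLIntegral_le_lintegral _ _
      _ = ∑ e, ENNReal.ofReal (a e) * volume (B e) := by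
          rw [lintegral_finsetSum _ fun e _ => measurable_const.indicator (hB e)]
          exact Finset.sum_congr rfl fun e _ => lintegral_indicator_const (hB e) _
      _ ≤ ∑ e, ENNReal.ofReal (a e) * ENNReal.ofReal (u e) :=
          Finset.sum_le_sum fun e _ => mul_le_mul_right (hvol e) _
      _ = ENNReal.ofReal (∑ e, a e * u e) := by
          rw [ENNReal.ofReal_sum_of_nonneg fun e _ => mul_nonneg (ha e) (hu e)]
          exact Finset.sum_congr rfl fun e _ => (ENNReal.ofReal_mul (ha e)).symm
  exact (ENNReal.ofReal_le_ofReal_iff hnn).1 h1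

/-! ### Simple paths and balls for an edge cost. -/

section SimplePaths

variable {W : Type*}

/-- `p 0, …, p n` is a simple path from `o` whose `i`-th step has cost `c i`, where `R x y c` says
that there is an edge of cost `c` from `x` to `y`. -/
structure IsSimplePath (R : W → W → ℝ → Prop) (o : W) (n : ℕ) (p : ℕ → W) (c : ℕ → ℝ) : Prop where
  zero : p 0 = o
  injOn : Set.InjOn p (Set.Iic n)
  step : ∀ i < n, R (p i) (p (i + 1)) (c i)

/-- The vertices that can be reached from `o` by simple paths of total cost at most `r`. -/
def reachSet (R : W → W → ℝ → Prop) (o : W) (r : ℝ) : Set W :=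
  {y | ∃ n p c, IsSimplePath R o n p c ∧ p n = y ∧ ∑ i ∈ Finset.range n, c i ≤ r}

variable {R : W → W → ℝ → Prop} {o : W}

lemma IsSimplePath.of_le {n m : ℕ} {p : ℕ → W} {c : ℕ → ℝ} (h : IsSimplePath R o n p c)
    (hm : m ≤ n) : IsSimplePath R o m p c :=
  ⟨h.zero, h.injOn.mono (Set.Iic_subset_Iic.2 hm), fun i hi => h.step i (hi.trans_le hm)⟩

lemma IsSimplePath.sum_mono (hR : ∀ x y c, R x y c → 0 ≤ c) {n m : ℕ} {p : ℕ → W} {c : ℕ → ℝ}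
    (h : IsSimplePath R o n p c) (hm : m ≤ n) :
    ∑ i ∈ Finset.range m, c i ≤ ∑ i ∈ Finset.range n, c i :=
  Finset.sum_le_sum_of_subset_of_nonneg (Finset.range_subset_range.2 hm) fun i hi _ =>
    hR _ _ _ (h.step i (Finset.mem_range.1 hi))

lemma monotone_reachSet : Monotone (reachSet R o) :=
  fun _ _ h _ ⟨n, p, c, hp, hy, hc⟩ => ⟨n, p, c, hp, hy, hc.trans h⟩

lemma self_mem_reachSet {r : ℝ} (hr : 0 ≤ r) : o ∈ reachSet R o r :=
  ⟨0, fun _ => o, fun _ => 0, ⟨rfl, by simp [Set.InjOn], by simp⟩, rfl, by simpa using hr⟩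

/-- If `y` already lies on the path, stopping there keeps it simple and, costs being nonnegative, no
dearer. Otherwise the edge is appended. -/
lemma reachSet_step (hR : ∀ x y c, R x y c → 0 ≤ c) {x y : W} {u r : ℝ} (hxy : R x y u)
    (hx : x ∈ reachSet R o r) : y ∈ reachSet R o (r + u) := by
  obtain ⟨n, p, c, hp, rfl, hc⟩ := hx
  have hu := hR _ _ _ hxy
  by_cases hy : ∃ m ≤ n, p m = y
  · obtain ⟨m, hm, rfl⟩ := hy
    exact ⟨m, p, c, hp.of_le hm, rfl, by linarith [hp.sum_mono hR hm]⟩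
  · push Not at hy
    refine ⟨n + 1, Function.update p (n + 1) y, Function.update c n u, ⟨?_, ?_, ?_⟩, by simp, ?_⟩
    · rw [Function.update_of_ne (by simp), hp.zero]
    · intro i hi j hj hij
      rw [Set.mem_Iic] at hi hj
      rcases Nat.le_succ_iff.1 hi with hi' | rfl <;> rcases Nat.le_succ_iff.1 hj with hj' | rfl
      · rw [Function.update_of_ne (by omega), Function.update_of_ne (by omega)] at hij
        exact hp.injOn hi' hj' hij
      · rw [Function.update_of_ne (by omega), Function.update_self] at hij
        exact absurd hij (hy i hi')
      · rw [Function.update_self, Function.update_of_ne (by omega)] at hij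
        exact absurd hij.symm (hy j hj')
      · rfl
    · intro i hi
      rcases Nat.lt_succ_iff_lt_or_eq.1 hi with hi' | rfl
      · rw [Function.update_of_ne (by omega), Function.update_of_ne (by omega),
          Function.update_of_ne (by omega)]
        exact hp.step i hi'
      · rw [Function.update_of_ne (by omega), Function.update_self, Function.update_self]
        exact hxy
    · rw [Finset.sum_range_succ, Function.update_self]
      have h : ∑ i ∈ Finset.range n, Function.update c n u i = ∑ i ∈ Finset.range n, c i :=
        Finset.sum_congr rfl fun i hi => by
          rw [Function.update_of_ne (Finset.mem_range.1 hi).ne]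
      linarith

/-- Prefixes of a cheap path are cheap, so the path stays inside the ball: the ball is connected
from `o` by its own edges. -/
lemma reflTransGen_of_mem_reachSet (hR : ∀ x y c, R x y c → 0 ≤ c) {y : W} {r : ℝ}
    (hy : y ∈ reachSet R o r) :
    Relation.ReflTransGen
      (fun a b => (∃ c, R a b c) ∧ a ∈ reachSet R o r ∧ b ∈ reachSet R o r) o y := by
  obtain ⟨n, p, c, hp, rfl, hc⟩ := hy
  have hmem : ∀ m ≤ n, p m ∈ reachSet R o r := fun m hm =>
    ⟨m, p, c, hp.of_le hm, rfl, (hp.sum_mono hR hm).trans hc⟩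
  have key : ∀ m ≤ n, Relation.ReflTransGen
      (fun a b => (∃ c, R a b c) ∧ a ∈ reachSet R o r ∧ b ∈ reachSet R o r) o (p m) := by
    intro m
    induction m with
    | zero => exact fun _ => by rw [hp.zero]
    | succ m ih =>
      intro hm
      exact (ih (by omega)).tail ⟨⟨_, hp.step m hm⟩, hmem m (by omega), hmem _ hm⟩
  exact key n le_rfl

end SimplePaths

/-! ### Integrals of products -/

lemma lintegral_pi_prod {ι : Type*} [Fintype ι] {Ω : ι → Type*} [∀ i, MeasurableSpace (Ω i)]
    (μ : ∀ i, Measure (Ω i)) [∀ i, IsProbabilityMeasure (μ i)] {F : ∀ i, Ω i → ℝ≥0∞}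
    (hF : ∀ i, Measurable (F i)) :
    ∫⁻ ω, ∏ i, F i (ω i) ∂(Measure.pi μ) = ∏ i, ∫⁻ x, F i x ∂(μ i) := by
  rw [lintegral_prod_eq_prod_lintegral_of_indepFun Finset.univ (fun i (ω : ∀ i, Ω i) => F i (ω i))
    (iIndepFun_pi (μ := μ) fun i => (hF i).aemeasurable) fun i => (hF i).comp (measurable_pi_apply i)]
  exact Finset.prod_congr rfl fun i _ => (measurePreserving_eval μ i).lintegral_comp (hF i)

lemma lintegral_infinitePi_prod {ι : Type*} {Ω : ι → Type*} [∀ i, MeasurableSpace (Ω i)]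
    (μ : ∀ i, Measure (Ω i)) [∀ i, IsProbabilityMeasure (μ i)] (s : Finset ι)
    {F : ∀ i, Ω i → ℝ≥0∞} (hF : ∀ i, Measurable (F i)) :
    ∫⁻ ω, ∏ i ∈ s, F i (ω i) ∂(Measure.infinitePi μ) = ∏ i ∈ s, ∫⁻ x, F i x ∂(μ i) := by
  rw [lintegral_prod_eq_prod_lintegral_of_indepFun s (fun i (ω : ∀ i, Ω i) => F i (ω i))
    (iIndepFun_infinitePi (P := μ) fun i => hF i) fun i => (hF i).comp (measurable_pi_apply i)]
  exact Finset.prod_congr rfl fun i _ =>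
    (measurePreserving_eval_infinitePi μ i).lintegral_comp (hF i)

/-! ### The walk along a simple path -/

section Walk

variable {W : Type*} [Fintype W] {G : Digraph W} {δ : W}

/-- The edges of the graph. -/
abbrev Edge (G : Digraph W) (δ : W) : Type _ := Σ x : {x : W // x ≠ δ}, Out G x.1

/-- The cost `-log ω(e)` of an edge. -/
noncomputable def edgeCost (ω : Env G δ) (e : Edge G δ) : ℝ := -Real.log ((ω e.1).1 e.2)

/-- There is an edge of cost `c` from `x` to `y`. -/
def HasCost (ω : Env G δ) (x y : W) (c : ℝ) : Prop :=
  ∃ e : Edge G δ, e.1.1 = x ∧ e.2.1 = y ∧ c = edgeCost ω e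

open scoped Classical in
lemma Simplex.le_one {ι : Type*} [Fintype ι] (p : Simplex ι) (i : ι) : p.1 i ≤ 1 := by
  rw [← p.2.2]
  exact Finset.single_le_sum (fun j _ => (p.2.1 j).le) (Finset.mem_univ i)

lemma edgeCost_nonneg (ω : Env G δ) (e : Edge G δ) : 0 ≤ edgeCost ω e := by
  classical
  exact neg_nonneg.2 (Real.log_nonpos ((ω e.1).2.1 _).le (Simplex.le_one _ _))

lemma exp_neg_edgeCost (ω : Env G δ) (e : Edge G δ) :
    Real.exp (-edgeCost ω e) = (ω e.1).1 e.2 := by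
  rw [edgeCost, neg_neg, Real.exp_log ((ω e.1).2.1 _)]

lemma HasCost.nonneg {ω : Env G δ} {x y : W} {c : ℝ} (h : HasCost ω x y c) : 0 ≤ c := by
  obtain ⟨e, -, -, rfl⟩ := h
  exact edgeCost_nonneg ω e

lemma HasCost.le_step {ω : Env G δ} {x y : W} {c : ℝ} (h : HasCost ω x y c) :
    ENNReal.ofReal (Real.exp (-c)) ≤ step ω x y := by
  classical
  obtain ⟨⟨⟨x, hx⟩, y⟩, rfl, rfl, rfl⟩ := h
  rw [exp_neg_edgeCost, step, dif_neg hx, PMF.map_apply]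
  refine le_trans ?_ (ENNReal.le_tsum y)
  simp [exitPMF]

variable [MeasurableSpace W] [DiscreteMeasurableSpace W]

/-- The probability that the walk follows a given trajectory. -/
lemma prod_step_le_walkLaw (ω : Env G δ) (p : ℕ → W) (n : ℕ) :
    ∏ i ∈ Finset.range n, step ω (p i) (p (i + 1)) ≤
      walkLaw ω (p 0) {Z | ∀ i ≤ n, Z i = p i} := by
  have hcyl : ∀ m, {Z : ℕ → W | ∀ i ≤ m, Z i = p i} =
      Preorder.frestrictLe (π := fun _ => W) m ⁻¹' {fun i : Finset.Iic m => p i} := by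
    intro m
    ext Z
    simp [funext_iff, Preorder.frestrictLe]
  -- The law of the trajectory given its history up to time `m` is carried by trajectories with that
  -- history.
  have hdirac : ∀ m, Kernel.traj (X := fun _ => W) (nextKernel ω) m (fun i => p i)
      {Z | ∀ i ≤ m, Z i = p i}ᶜ = 0 := by
    intro m
    rw [hcyl, ← Set.preimage_compl, ← Measure.map_apply (Preorder.measurable_frestrictLe _) (by measurability),
      Kernel.traj_map_frestrictLe_apply, Kernel.partialTraj_self, Kernel.id_apply,
      Measure.dirac_apply' _ (by measurability)]
    simp
  induction n with
  | zero =>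
    have h := hdirac 0
    have hx : (fun i : Finset.Iic 0 => p i) = fun _ => p 0 := by
      ext ⟨i, hi⟩
      simp at hi
      simp [hi]
    rw [hx] at h
    have hmeas : MeasurableSet {Z : ℕ → W | ∀ i ≤ 0, Z i = p i} := by
      rw [hcyl]
      exact Preorder.measurable_frestrictLe (X := fun _ => W) 0 (by measurability)
    exact (((prob_compl_eq_zero_iff hmeas).1 h).symm).le
  | succ n ih =>
    have hnext : step ω (p n) (p (n + 1)) ≤ Kernel.traj (X := fun _ => W) (nextKernel ω) n
        (fun i => p i) {Z | ∀ i ≤ n + 1, Z i = p i} := by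
      have h1 : step ω (p n) (p (n + 1)) = Kernel.traj (X := fun _ => W) (nextKernel ω) n
          (fun i => p i) {Z | Z (n + 1) = p (n + 1)} := by
        have h2 : nextKernel ω n (fun i => p i) {p (n + 1)} = step ω (p n) (p (n + 1)) :=
          PMF.toMeasure_apply_singleton (step ω (p n)) _ (by measurability)
        rw [← h2, ← Kernel.map_traj_succ_self (X := fun _ => W) (κ := nextKernel ω) (a := n),
          Kernel.map_apply' _ (measurable_pi_apply _) _ (by measurability)]
        rfl
      rw [h1]
      refine measure_mono_ae ?_
      have h3 : ∀ᵐ Z ∂(Kernel.traj (X := fun _ => W) (nextKernel ω) n fun i => p i),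
          ∀ i ≤ n, Z i = p i := hdirac n
      filter_upwards [h3] with Z hZ hZ1 i hi
      rcases Nat.le_succ_iff.1 hi with hi | rfl
      · exact hZ i hi
      · exact hZ1
    have hmeas : MeasurableSet {Z : ℕ → W | ∀ i ≤ n + 1, Z i = p i} := by
      rw [hcyl]
      exact Preorder.measurable_frestrictLe (X := fun _ => W) (n + 1) (by measurability)
    rw [Finset.prod_range_succ, walkLaw, ← Kernel.traj_comp_partialTraj (Nat.zero_le n),
      Kernel.comp_apply' _ _ _ hmeas]
    have hn : walkLaw ω (p 0) {Z | ∀ i ≤ n, Z i = p i} =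
        Kernel.partialTraj (X := fun _ => W) (nextKernel ω) 0 n (fun _ => p 0)
          {fun i : Finset.Iic n => p i} := by
      rw [← Kernel.traj_map_frestrictLe_apply, Measure.map_apply (Preorder.measurable_frestrictLe _) (by measurability),
        ← hcyl]
      rfl
    -- Markov property at time `n`: the integral over histories is bounded below by the contribution
    -- of the single history `p 0, …, p n`.
    calc _ ≤ walkLaw ω (p 0) {Z | ∀ i ≤ n, Z i = p i} *
          Kernel.traj (X := fun _ => W) (nextKernel ω) n
            (fun i => p i) {Z | ∀ i ≤ n + 1, Z i = p i} := mul_le_mul' ih hnext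
      _ = ∫⁻ y in {fun i : Finset.Iic n => p i}, Kernel.traj (X := fun _ => W) (nextKernel ω) n y
            {Z | ∀ i ≤ n + 1, Z i = p i}
            ∂(Kernel.partialTraj (X := fun _ => W) (nextKernel ω) 0 n (fun _ => p 0)) := by
          rw [lintegral_singleton, hn, mul_comm]
      _ ≤ _ := setLIntegral_le_lintegral _ _

/-- Following the path realises the event in the definition of `gamma`: its vertices are distinct,
so neither a return nor a loop occurs by time `n`. The probability of following it is at least `exp`
of minus its cost. -/
lemma IsSimplePath.gamma_le {ω : Env G δ} {o : W} {n : ℕ} {p : ℕ → W} {c : ℕ → ℝ}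
    (h : IsSimplePath (HasCost ω) o n p c) (hn : p n = δ) :
    gamma ω o ≤ ENNReal.ofReal (Real.exp (∑ i ∈ Finset.range n, c i)) := by
  have h1 : ENNReal.ofReal (Real.exp (-∑ i ∈ Finset.range n, c i)) ≤
      walkLaw ω o {Z | hitTime δ Z < min (returnTime o Z) (loopTime Z)} := by
    rw [← Finset.sum_neg_distrib, Real.exp_sum,
      ENNReal.ofReal_prod_of_nonneg fun i _ => (Real.exp_pos _).le]
    refine (Finset.prod_le_prod' fun i hi =>
      (h.step i (Finset.mem_range.1 hi)).le_step).trans ?_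
    refine (prod_step_le_walkLaw ω p n).trans ?_
    rw [h.zero]
    refine measure_mono fun Z (hZ : ∀ i ≤ n, Z i = p i) => ?_
    have hit : hitTime δ Z ≤ n := iInf₂_le n ((hZ n le_rfl).trans hn)
    have hloop : ∀ k m : ℕ, m < k → Z k = Z m → n + 1 ≤ k := by
      intro k m hmk hkm
      by_contra! hk
      rw [hZ k (by omega), hZ m (by omega)] at hkm
      exact hmk.ne' (h.injOn (by simp; omega) (by simp; omega) hkm)
    have hn1 : (n : ℕ∞) < ((n + 1 : ℕ) : ℕ∞) := by exact_mod_cast n.lt_succ_self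
    refine hit.trans_lt (hn1.trans_le (le_min ?_ ?_))
    · refine le_iInf₂ fun k hk => ?_
      have h0 : Z 0 = o := (hZ 0 (Nat.zero_le n)).trans h.zero
      exact_mod_cast hloop k 0 hk.1 (hk.2.trans h0.symm)
    · refine le_iInf₂ fun k hk => ?_
      obtain ⟨-, m, hm, hkm⟩ := hk
      exact_mod_cast hloop k m hm hkm
  rw [gamma, ENNReal.inv_le_iff_inv_le, ← ENNReal.ofReal_inv_of_pos (Real.exp_pos _),
    ← Real.exp_neg]
  exact h1

end Walk

/-! ### Finite graphs -/

/-- Some coordinate is at least the average. Applied at the starting point, this puts a neighbour in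
every ball beyond a deterministic radius. -/
lemma Simplex.exists_inv_card_le {ι : Type*} [Fintype ι] (p : Simplex ι) :
    ∃ i, (Fintype.card ι : ℝ)⁻¹ ≤ p.1 i := by
  by_contra! h
  have hne : (Finset.univ : Finset ι).Nonempty := by
    rw [Finset.nonempty_iff_ne_empty]
    intro h0
    have := p.2.2
    rw [h0] at this
    simp at this
  have h1 := Finset.sum_lt_sum_of_nonempty hne fun i _ => h i
  have h2 : (Fintype.card ι : ℝ) ≠ 0 := by
    have : 0 < Fintype.card ι := Finset.card_pos.2 hne
    positivity
  rw [p.2.2, Finset.sum_const, Finset.card_univ, nsmul_eq_mul, mul_inv_cancel₀ h2] at h1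
  exact h1.false

/-- On an empty index set `dirichlet` is `0` by convention; a path to `δ` excludes this case. -/
lemma nonempty_out {W : Type*} {G : Digraph W} {δ : W} (hG : IsCemetery G δ)
    (x : {x : W // x ≠ δ}) : Nonempty (Out G x.1) := by
  rcases Relation.ReflTransGen.cases_head (hG.2 x.1) with h | ⟨z, hz, -⟩
  · exact absurd h x.2
  · exact ⟨⟨z, hz⟩⟩

/-- The set of the edges of `G` between vertices of `U`. -/
def edgesIn {W : Type*} (G : Digraph W) (U : Set W) : Set (W × W) := {e | G.Adj e.1 e.2 ∧ e.1 ∈ U ∧ e.2 ∈ U}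

/-- A vertex set `U` that is connected from `o` and has at least two points is the vertex set of a
strongly connected set of edges. -/
lemma isStronglyConnected_edgesIn {W : Type*} {G : Digraph W} {δ : W} {U : Set W} {o y : W}
    (hsymm : ∀ x y, G.Adj x y → y ≠ δ → G.Adj y x) (hδ : δ ∉ U) (ho : o ∈ U) (hy : y ∈ U)
    (hoy : G.Adj o y)
    (hU : ∀ x ∈ U, Relation.ReflTransGen (fun a b => (a, b) ∈ edgesIn G U) o x) :
    IsStronglyConnected G (edgesIn G U) ∧ tails (edgesIn G U) = U := by
  -- Since `δ ∉ U`, every edge inside `U` can be reversed.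
  have hsw : ∀ a b, (a, b) ∈ edgesIn G U → (b, a) ∈ edgesIn G U := by
    rintro a b ⟨h1, h2, h3⟩
    exact ⟨hsymm a b h1 fun h => hδ (h ▸ h3), h3, h2⟩
  have hback : ∀ x ∈ U, Relation.ReflTransGen (fun a b => (a, b) ∈ edgesIn G U) x o := by
    intro x hx
    have : Std.Symm fun a b => (a, b) ∈ edgesIn G U := ⟨hsw⟩
    exact Std.Symm.symm _ _ (hU x hx)
  have hmem : ∀ x ∈ heads (edgesIn G U) ∪ tails (edgesIn G U), x ∈ U := by
    rintro x (⟨e, he, rfl⟩ | ⟨e, he, rfl⟩)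
    · exact he.2.2
    · exact he.2.1
  refine ⟨⟨fun e he => he.1, fun x hx z hz => (hback x (hmem x hx)).trans (hU z (hmem z hz))⟩, ?_⟩
  refine Set.Subset.antisymm (fun x hx => hmem x (Or.inr hx)) fun x hx => ?_
  -- The neighbour `y` serves to make `o` itself a tail, even if `o` is reached only by the empty
  -- path.
  rcases Relation.ReflTransGen.cases_tail (hU x hx) with h | ⟨z, -, hz⟩
  · subst h
    exact ⟨(_, y), ⟨hoy, ho, hy⟩, rfl⟩
  · exact ⟨(x, z), hsw _ _ hz, rfl⟩

/-! ### The tail of `γ` on a finite graph. -/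

section FiniteGraph

variable {W : Type*} [Fintype W] {G : Digraph W} {δ : W}

lemma exitSum_eq_sum_edge [DecidableEq W] (hδ : ∀ y, ¬ G.Adj δ y) (α : W → W → ℝ) (A : Set (W × W))
    [DecidablePred fun e : Edge G δ => e.1.1 ∈ tails A ∧ e.2.1 ∉ tails A] [Fintype (Edge G δ)] :
    exitSum G α A = ∑ e : Edge G δ with e.1.1 ∈ tails A ∧ e.2.1 ∉ tails A, α e.1.1 e.2.1 := by
  classical
  symm
  refine Finset.sum_bij (fun e _ => (e.1.1, e.2.1)) ?_ ?_ ?_ ?_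
  · intro e he
    simp only [Finset.mem_filter, Finset.mem_univ, true_and] at he ⊢
    exact ⟨e.2.2, he⟩
  · rintro ⟨⟨x, hx⟩, ⟨y, hy⟩⟩ _ ⟨⟨x', hx'⟩, ⟨y', hy'⟩⟩ _ h
    simp only [Prod.mk.injEq] at h
    obtain ⟨rfl, rfl⟩ := h
    rfl
  · rintro ⟨x, y⟩ h
    simp only [Finset.mem_filter, Finset.mem_univ, true_and] at h
    refine ⟨⟨⟨x, fun hx => hδ y (hx ▸ h.1)⟩, ⟨y, h.1⟩⟩, ?_, rfl⟩
    simpa using h.2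
  · intro e _
    rfl

lemma prod_rpow_eq_exp (ω : Env G δ) [Fintype (Edge G δ)] (b : Edge G δ → ℝ) :
    ∏ e, (ω e.1).1 e.2 ^ b e = Real.exp (-∑ e, b e * edgeCost ω e) := by
  rw [← Finset.sum_neg_distrib, Real.exp_sum]
  refine Finset.prod_congr rfl fun e _ => ?_
  rw [Real.rpow_def_of_pos ((ω e.1).2.1 e.2), edgeCost]
  ring_nf

open scoped Classical in
/-- The negative moments of the environment blow up at most polynomially when the exponents
approach the critical ones. -/
lemma exists_lintegral_envLaw_le (hG : IsCemetery G δ) {α : W → W → ℝ}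
    (hα : ∀ x y, G.Adj x y → 0 < α x y) : ∃ C : ℝ, 0 < C ∧ ∀ ε ∈ Set.Ioc (0 : ℝ) 1,
      ∫⁻ ω, ENNReal.ofReal (∏ e : Edge G δ, (ω e.1).1 e.2 ^ (ε - α e.1.1 e.2.1))
        ∂(envLaw G δ α) ≤ ENNReal.ofReal (C * ε⁻¹ ^ Fintype.card (Edge G δ)) := by
  have hne := nonempty_out hG
  have hpos : ∀ (x : {x : W // x ≠ δ}) (y : Out G x.1), 0 < α x.1 y.1 := fun x y => hα _ _ y.2
  choose C hC h using fun x : {x : W // x ≠ δ} =>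
    exists_lintegral_dirichlet_le (a := fun y : Out G x.1 => α x.1 y.1) (hpos x)
  have hprob := fun x : {x : W // x ≠ δ} =>
    isProbabilityMeasure_dirichlet (a := fun y : Out G x.1 => α x.1 y.1) (hpos x)
  refine ⟨∏ x, C x, Finset.prod_pos fun x _ => hC x, fun ε hε => ?_⟩
  have hprod : ∀ ω : Env G δ,
      ENNReal.ofReal (∏ e : Edge G δ, (ω e.1).1 e.2 ^ (ε - α e.1.1 e.2.1)) =
        ∏ x, ENNReal.ofReal (∏ y, (ω x).1 y ^ (ε - α x.1 y.1)) := by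
    intro ω
    rw [Fintype.prod_sigma, ENNReal.ofReal_prod_of_nonneg]
    exact fun x _ => Finset.prod_nonneg fun y _ => Real.rpow_nonneg ((ω x).2.1 y).le _
  have hF : ∀ x : {x : W // x ≠ δ}, Measurable fun p : Simplex (Out G x.1) =>
      ENNReal.ofReal (∏ y, p.1 y ^ (ε - α x.1 y.1)) := fun x =>
    (Finset.measurable_prod _ fun y _ =>
      ((measurable_pi_apply y).comp measurable_subtype_coe).pow_const _).ennreal_ofReal
  rw [lintegral_congr hprod, envLaw, lintegral_pi_prod _ hF]
  refine (Finset.prod_le_prod' fun x _ => h x ε hε).trans ?_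
  have hε0 := hε.1
  rw [← ENNReal.ofReal_prod_of_nonneg fun x _ => by have := hC x; positivity,
    Finset.prod_mul_distrib, Finset.prod_pow_eq_pow_sum, Fintype.card_sigma]

variable [MeasurableSpace W] [DiscreteMeasurableSpace W]

open scoped Classical in
/-- On the event `γ > t`, the product of the `ω(e) ^ (-a e)` is at least of order `t ^ s`, if the
weights `a` of the edges that exit the strongly connected sets at `o` sum to at least `s`. -/
lemma mul_log_le_sum_of_lt_gamma (hsymm : ∀ x y, G.Adj x y → y ≠ δ → G.Adj y x) {o : W}
    (ho : o ≠ δ) {a : Edge G δ → ℝ} (ha : ∀ e, 0 ≤ a e) {s : ℝ}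
    (hcut : ∀ A, IsStronglyConnected G A → o ∈ tails A →
      s ≤ ∑ e : Edge G δ with e.1.1 ∈ tails A ∧ e.2.1 ∉ tails A, a e)
    {ω : Env G δ} {t : ℝ} (ht : (Fintype.card W : ℝ) ≤ t) (hω : ENNReal.ofReal t < gamma ω o) :
    s * (Real.log t - Real.log (Fintype.card W)) ≤ ∑ e, a e * edgeCost ω e := by
  have hcard : (1 : ℝ) ≤ Fintype.card W := by exact_mod_cast Fintype.card_pos_iff.2 ⟨o⟩
  have hR : ∀ x y c, HasCost ω x y c → 0 ≤ c := fun _ _ _ h => h.nonneg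
  refine mul_le_sum_of_forall_le_cut (src := fun e : Edge G δ => e.1.1) (tgt := fun e => e.2.1)
    ha (edgeCost_nonneg ω) (U := reachSet (HasCost ω) o) monotone_reachSet
    (fun e r => reachSet_step hR ⟨e, rfl, rfl, rfl⟩)
    (Real.log_le_log (by linarith) ht) fun r hr hrt => ?_
  -- A path to `δ` of cost at most `r < log t` would give `γ ≤ t`.
  have hδ : δ ∉ reachSet (HasCost ω) o r := by
    rintro ⟨n, p, c, hp, hn, hc⟩
    refine (hp.gamma_le hn).not_gt (lt_of_le_of_lt (ENNReal.ofReal_le_ofReal ?_) hω)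
    calc _ ≤ Real.exp (Real.log t) := Real.exp_le_exp.2 (hc.trans hrt.le)
      _ = t := Real.exp_log (by linarith)
  have hoU : o ∈ reachSet (HasCost ω) o r := self_mem_reachSet ((Real.log_nonneg hcard).trans hr)
  obtain ⟨y, hy⟩ := (ω ⟨o, ho⟩).exists_inv_card_le
  have hyU : y.1 ∈ reachSet (HasCost ω) o r := by
    refine monotone_reachSet ?_ (reachSet_step hR (u := edgeCost ω ⟨⟨o, ho⟩, y⟩)
      ⟨⟨⟨o, ho⟩, y⟩, rfl, rfl, rfl⟩ (self_mem_reachSet le_rfl))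
    rw [zero_add]
    refine le_trans ?_ hr
    have h0 : 0 < Fintype.card (Out G o) := Fintype.card_pos_iff.2 ⟨y⟩
    have h1 : (Fintype.card (Out G o) : ℝ) ≤ Fintype.card W := by
      exact_mod_cast Fintype.card_subtype_le _
    have h2 : (0 : ℝ) < Fintype.card (Out G o) := by exact_mod_cast h0
    rw [edgeCost, neg_le, ← Real.log_inv]
    exact Real.log_le_log (by positivity) ((inv_anti₀ h2 h1).trans hy)
  have hpath : ∀ x ∈ reachSet (HasCost ω) o r, Relation.ReflTransGen
      (fun a b => (a, b) ∈ edgesIn G (reachSet (HasCost ω) o r)) o x := by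
    intro x hx
    refine Relation.ReflTransGen.mono ?_ o x (reflTransGen_of_mem_reachSet hR hx)
    rintro a b ⟨⟨c, e, rfl, rfl, -⟩, h1, h2⟩
    exact ⟨e.2.2, h1, h2⟩
  obtain ⟨hA, htails⟩ := isStronglyConnected_edgesIn hsymm hδ hoU hyU y.2 hpath
  have := hcut _ hA (by rwa [htails])
  rwa [htails] at this

open scoped Classical in
/-- The tail of `γ` on a finite graph. -/
theorem gamma_tail (hG : IsCemetery G δ) (hsymm : ∀ x y, G.Adj x y → y ≠ δ → G.Adj y x)
    {α : W → W → ℝ} (hα : ∀ x y, G.Adj x y → 0 < α x y) {o : W} (ho : o ≠ δ) {β : ℝ}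
    (hβ : IsLeast (exitSums G α o) β) :
    ∃ C r : ℝ, 0 < C ∧ 0 < r ∧ ∀ᶠ t : ℝ in atTop,
      envLaw G δ α {ω | ENNReal.ofReal t < gamma ω o} ≤
        ENNReal.ofReal (C * Real.log t ^ r / t ^ β) := by
  obtain ⟨C, hC, h⟩ := exists_lintegral_envLaw_le hG hα
  set m : ℕ := Fintype.card (Edge G δ) with hm
  set k : ℝ := Real.log (Fintype.card W) with hk
  have hcard : (1 : ℝ) ≤ Fintype.card W := by exact_mod_cast Fintype.card_pos_iff.2 ⟨o⟩
  have hk0 : 0 ≤ k := Real.log_nonneg hcard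
  -- The factor `exp (β k)` comes from starting the cut integral at radius `k`, and `exp m` from
  -- lowering `m` exponents by `1 / log t`. Taking `m + 1` instead of `m` makes the power of the
  -- logarithm plainly positive.
  refine ⟨C * Real.exp (β * k + m), m + 1, by positivity, by positivity, ?_⟩
  have hsmall : ∀ᶠ t : ℝ in atTop, ∀ e : Edge G δ, (Real.log t)⁻¹ ≤ α e.1.1 e.2.1 := by
    refine eventually_all.2 fun e => ?_
    exact ((tendsto_inv_atTop_zero.comp Real.tendsto_log_atTop).eventually
      (gt_mem_nhds (hα _ _ e.2.2))).mono fun t ht => ht.le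
  filter_upwards [hsmall, eventually_ge_atTop (Fintype.card W : ℝ),
    Real.tendsto_log_atTop.eventually_ge_atTop 1] with t hε ht hT
  have ht0 : 0 < t := by linarith
  set T : ℝ := Real.log t with hTdef
  have hT0 : 0 < T := by linarith
  have hT1 : T⁻¹ * T = 1 := inv_mul_cancel₀ hT0.ne'
  have hsub : {ω : Env G δ | ENNReal.ofReal t < gamma ω o} ⊆
      {ω | ENNReal.ofReal (Real.exp ((β - m * T⁻¹) * (T - k))) ≤
        ENNReal.ofReal (∏ e : Edge G δ, (ω e.1).1 e.2 ^ (T⁻¹ - α e.1.1 e.2.1))} := by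
    intro ω hω
    refine ENNReal.ofReal_le_ofReal ?_
    rw [prod_rpow_eq_exp]
    refine Real.exp_le_exp.2 ?_
    refine (mul_log_le_sum_of_lt_gamma hsymm ho (a := fun e => α e.1.1 e.2.1 - T⁻¹)
      (fun e => sub_nonneg.2 (hε e)) (fun A hA hoA => ?_) ht hω).trans_eq ?_
    -- Lowering every weight by `T⁻¹` lowers a cut by at most `m * T⁻¹`.
    · have h1 : β ≤ exitSum G α A := hβ.2 ⟨A, hA, hoA, rfl⟩
      rw [exitSum_eq_sum_edge hG.1] at h1
      rw [Finset.sum_sub_distrib, Finset.sum_const, nsmul_eq_mul]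
      have h2 : ((Finset.univ.filter fun e : Edge G δ =>
          e.1.1 ∈ tails A ∧ e.2.1 ∉ tails A).card : ℝ) ≤ m := by
        exact_mod_cast Finset.card_le_univ _
      have h3 := mul_le_mul_of_nonneg_right h2 (inv_nonneg.2 hT0.le)
      linarith
    · rw [← Finset.sum_neg_distrib]
      exact Finset.sum_congr rfl fun e _ => by ring
  have hmeas : Measurable fun ω : Env G δ =>
      ENNReal.ofReal (∏ e : Edge G δ, (ω e.1).1 e.2 ^ (T⁻¹ - α e.1.1 e.2.1)) := by
    refine (Finset.measurable_prod _ fun e _ => Measurable.pow_const ?_ _).ennreal_ofReal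
    exact (measurable_pi_apply e.2).comp (measurable_subtype_coe.comp (measurable_pi_apply e.1))
  refine (measure_mono hsub).trans ((meas_ge_le_lintegral_div hmeas.aemeasurable
    (by simp [Real.exp_pos]) ENNReal.ofReal_ne_top).trans ?_)
  refine (ENNReal.div_le_div_right (h T⁻¹ ⟨by positivity, inv_le_one_of_one_le₀ hT⟩) _).trans ?_
  rw [← ENNReal.ofReal_div_of_pos (Real.exp_pos _), inv_inv]
  refine ENNReal.ofReal_le_ofReal ?_
  have hpow : T ^ m ≤ T ^ ((m : ℝ) + 1) := by
    rw [← Real.rpow_natCast]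
    exact Real.rpow_le_rpow_of_exponent_le hT (by linarith)
  have hexp : (Real.exp ((β - m * T⁻¹) * (T - k)))⁻¹ ≤ Real.exp (β * k + m) / t ^ β := by
    rw [Real.rpow_def_of_pos ht0, ← hTdef, ← Real.exp_neg, ← Real.exp_sub]
    refine Real.exp_le_exp.2 ?_
    have h1 : (β - m * T⁻¹) * (T - k) = β * T - β * k - m * (T⁻¹ * T) + m * T⁻¹ * k := by ring
    have h2 : 0 ≤ m * T⁻¹ * k := by positivity
    rw [h1, hT1]
    linarith
  calc C * T ^ m / Real.exp ((β - m * T⁻¹) * (T - k))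
      ≤ C * T ^ ((m : ℝ) + 1) * (Real.exp (β * k + m) / t ^ β) := by
        rw [div_eq_mul_inv]
        exact mul_le_mul (mul_le_mul_of_nonneg_left hpow hC.le) hexp (by positivity)
          (by positivity)
    _ = C * Real.exp (β * k + m) * T ^ ((m : ℝ) + 1) / t ^ β := by ring

/-- If `o` is in no strongly connected set of edges, then `γ` is bounded. -/
theorem gamma_bounded (hsymm : ∀ x y, G.Adj x y → y ≠ δ → G.Adj y x)
    {α : W → W → ℝ} {o : W} (ho : o ≠ δ) (hempty : exitSums G α o = ∅) :
    ∀ᶠ t : ℝ in atTop, envLaw G δ α {ω | ENNReal.ofReal t < gamma ω o} = 0 := by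
  classical
  have hcard : (0 : ℝ) < Fintype.card W := by exact_mod_cast Fintype.card_pos_iff.2 ⟨o⟩
  filter_upwards [eventually_gt_atTop (Fintype.card W : ℝ)] with t ht
  convert measure_empty (μ := envLaw G δ α)
  refine Set.eq_empty_of_forall_notMem fun ω hω => ?_
  -- With no admissible `A` the cut condition is vacuous, so zero weights and `s = 1` are allowed;
  -- the bound then reads `log t ≤ log (card W)`.
  have h := mul_log_le_sum_of_lt_gamma hsymm ho (a := fun _ => 0) (fun _ => le_rfl) (s := 1)
    (fun A hA hoA => by
      have : exitSum G α A ∈ exitSums G α o := ⟨A, hA, hoA, rfl⟩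
      rw [hempty] at this
      exact this.elim) ht.le hω
  have := Real.log_lt_log hcard ht
  simp only [zero_mul, Finset.sum_const_zero] at h
  linarith

end FiniteGraph

/-! ### The lattice -/

/-! ### Edge isoperimetry in `ℤ^d`. -/

section Isoperimetry

variable {d : ℕ}

/-- The axis of a direction. -/
def axis : Dir d → Fin d := Sum.elim id id

lemma unitVec_axis_ne_zero (i : Dir d) : (unitVec i) (axis i) ≠ 0 := by
  rcases i with i | i <;> simp [unitVec, axis]

lemma unitVec_of_ne_axis {i : Dir d} {j : Fin d} (h : j ≠ axis i) : (unitVec i) j = 0 := by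
  rcases i with i | i <;> simp_all [unitVec, axis]

/-- From a point of a finite set `U`, one reaches the boundary of `U` in any direction. -/
lemma exists_exit {U : Set (Fin d → ℤ)} (hU : U.Finite) {z : Fin d → ℤ} (hz : z ∈ U) (i : Dir d) :
    ∃ n : ℕ, z + n • unitVec i ∈ U ∧ z + n • unitVec i + unitVec i ∉ U := by
  by_contra! h
  have hall : ∀ n : ℕ, z + n • unitVec i ∈ U := by
    intro n
    induction n with
    | zero => simpa using hz
    | succ n ih => simpa [add_smul, add_assoc] using h n ih
  refine Set.infinite_of_injective_forall_mem (f := fun n : ℕ => z + n • unitVec i) ?_ hall hU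
  intro m n hmn
  have h1 := congrFun hmn (axis i)
  simpa [unitVec_axis_ne_zero] using h1

open scoped Classical in
/-- The edge boundary of a finite set that contains two neighbours. -/
lemma kappa_le_sum_boundary {a : Dir d → ℝ} (ha : ∀ i, 0 ≤ a i) {S : Finset (Fin d → ℤ)}
    {U : Set (Fin d → ℤ)} (hUS : U ⊆ S) {y : Fin d → ℤ} {k : Dir d} (hy : y ∈ U)
    (hyk : y + unitVec k ∈ U) :
    kappa a ≤ ∑ e : S × Dir d with e.1.1 ∈ U ∧ e.1.1 + unitVec e.2 ∉ U, a e.2 := by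
  have hfin : U.Finite := S.finite_toSet.subset hUS
  let N : Dir d → Finset S := fun i =>
    Finset.univ.filter fun z : S => z.1 ∈ U ∧ z.1 + unitVec i ∉ U
  have hsum : ∑ e : S × Dir d with e.1.1 ∈ U ∧ e.1.1 + unitVec e.2 ∉ U, a e.2 =
      ∑ i, (N i).card * a i := by
    rw [Finset.sum_filter, Fintype.sum_prod_type_right]
    refine Finset.sum_congr rfl fun i _ => ?_
    rw [← Finset.sum_filter]
    exact (Finset.sum_const (a i)).trans (nsmul_eq_mul _ _)
  have hmem : ∀ i, ∀ z ∈ U, ∃ n : ℕ, ∃ w ∈ N i, w.1 = z + n • unitVec i := by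
    intro i z hz
    obtain ⟨n, h1, h2⟩ := exists_exit hfin hz i
    exact ⟨n, ⟨_, hUS h1⟩, by simpa [N] using ⟨h1, h2⟩, rfl⟩
  have hone : ∀ i, 1 ≤ (N i).card := by
    intro i
    obtain ⟨n, w, hw, -⟩ := hmem i y hy
    exact Finset.card_pos.2 ⟨w, hw⟩
  -- For a direction not parallel to `k`, the lines through `y` and `y + unitVec k` are disjoint:
  -- their points differ in the coordinate `axis k`. Each contains an exit point.
  have htwo : ∀ i, axis i ≠ axis k → 2 ≤ (N i).card := by
    intro i hi
    obtain ⟨n, w, hw, hwn⟩ := hmem i y hy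
    obtain ⟨n', w', hw', hwn'⟩ := hmem i _ hyk
    refine Finset.one_lt_card.2 ⟨w, hw, w', hw', fun h => ?_⟩
    rw [← h, hwn] at hwn'
    have h1 := congrFun hwn' (axis k)
    simp [unitVec_of_ne_axis hi.symm, unitVec_axis_ne_zero] at h1
  rw [hsum]
  have hk : a (Sum.inl (axis k)) + a (Sum.inr (axis k)) ≤
      ⨆ i : Fin d, (a (Sum.inl i) + a (Sum.inr i)) :=
    le_ciSup (f := fun i : Fin d => a (Sum.inl i) + a (Sum.inr i))
      (Set.finite_range _).bddAbove (axis k)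
  have hax : ∑ i : Dir d, (if axis i = axis k then a i else 0) =
      a (Sum.inl (axis k)) + a (Sum.inr (axis k)) := by
    rw [Fintype.sum_sum_type]
    generalize axis k = j
    simp only [axis, Sum.elim_inl, Sum.elim_inr, id]
    congr 1 <;> exact (Finset.sum_eq_single j (fun b _ hb => if_neg hb) (by simp)).trans (if_pos rfl)
  have hterm : ∀ i, 2 * a i - (if axis i = axis k then a i else 0) ≤ (N i).card * a i := by
    intro i
    split_ifs with h
    · have : (1 : ℝ) ≤ (N i).card := by exact_mod_cast hone i
      nlinarith [ha i]
    · have : (2 : ℝ) ≤ (N i).card := by exact_mod_cast htwo i h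
      nlinarith [ha i]
  calc kappa a ≤ 2 * ∑ i, a i - ∑ i : Dir d, (if axis i = axis k then a i else 0) := by
        rw [kappa, hax]
        linarith
    _ = ∑ i, (2 * a i - (if axis i = axis k then a i else 0)) := by
        rw [Finset.sum_sub_distrib, Finset.mul_sum]
    _ ≤ ∑ i, (N i).card * a i := Finset.sum_le_sum fun i _ => hterm i

end Isoperimetry

/-! ### Moments of `γ` on the lattice. -/

section Lattice

variable {d : ℕ}

/-- The cost `-log ω(y, y + e_i)`. -/
noncomputable def latticeCost (ω : LatticeEnv d) (y : Fin d → ℤ) (i : Dir d) : ℝ :=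
  -Real.log ((ω y).1 i)

/-- There is an edge of cost `c` from the vertex `y` of `S` to its neighbour `z`. -/
def HasLatticeCost (S : Finset (Fin d → ℤ)) (ω : LatticeEnv d) (y z : Fin d → ℤ) (c : ℝ) : Prop :=
  y ∈ S ∧ ∃ i, z = y + unitVec i ∧ c = latticeCost ω y i

lemma latticeCost_nonneg (ω : LatticeEnv d) (y : Fin d → ℤ) (i : Dir d) : 0 ≤ latticeCost ω y i :=
  neg_nonneg.2 (Real.log_nonpos ((ω y).2.1 _).le (Simplex.le_one _ _))

lemma exp_neg_latticeCost (ω : LatticeEnv d) (y : Fin d → ℤ) (i : Dir d) :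
    Real.exp (-latticeCost ω y i) = (ω y).1 i := by
  rw [latticeCost, neg_neg, Real.exp_log ((ω y).2.1 _)]

lemma exists_steps {S : Finset (Fin d → ℤ)} {ω : LatticeEnv d} (n : ℕ) (p : ℕ → Fin d → ℤ)
    (c : ℕ → ℝ) (h : ∀ i < n, HasLatticeCost S ω (p i) (p (i + 1)) (c i)) :
    ∃ σ, trail (p 0) σ = (List.range n).map (fun i => p (i + 1)) ∧
      pathWeight ω (p 0) σ = Real.exp (-∑ i ∈ Finset.range n, c i) := by
  induction n generalizing p c with
  | zero => exact ⟨[], by simp [trail], by simp [pathWeight]⟩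
  | succ n ih =>
    obtain ⟨σ, hσ, hw⟩ := ih (fun i => p (i + 1)) (fun i => c (i + 1))
      fun i hi => h (i + 1) (by omega)
    obtain ⟨-, j, hj, hc⟩ := h 0 n.succ_pos
    rw [zero_add] at hj
    rw [zero_add, hj] at hσ hw
    refine ⟨j :: σ, ?_, ?_⟩
    · rw [trail, hσ, List.range_succ_eq_map, List.map_cons, List.map_map, ← hj]
      rfl
    · rw [pathWeight, hw, Finset.sum_range_succ', neg_add, Real.exp_add, hc, exp_neg_latticeCost,
        mul_comm]

/-- The path contributes one term to the sum defining `1 / γ`. Since `HasLatticeCost` requires tails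
in `S`, only the last vertex is outside `x + Λ`. -/
lemma IsSimplePath.latticeGamma_le {Λ S : Finset (Fin d → ℤ)} {x : Fin d → ℤ}
    (hS : ∀ y, y ∈ S ↔ y - x ∈ Λ) {ω : LatticeEnv d} {n : ℕ} {p : ℕ → Fin d → ℤ} {c : ℕ → ℝ}
    (h : IsSimplePath (HasLatticeCost S ω) x n p c) (hn : p n ∉ S) :
    latticeGamma Λ ω x ≤ ENNReal.ofReal (Real.exp (∑ i ∈ Finset.range n, c i)) := by
  obtain ⟨σ, hσ, hw⟩ := exists_steps n p c h.step
  rw [h.zero] at hσ hw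
  have hlist : x :: trail x σ = (List.range (n + 1)).map p := by
    rw [hσ, List.range_succ_eq_map, List.map_cons, List.map_map, h.zero]
    rfl
  have hexit : IsExitPath Λ x σ := by
    refine ⟨?_, ?_, ?_⟩
    · rw [hlist]
      refine List.Nodup.map_on (fun i hi j hj hij => h.injOn ?_ ?_ hij) List.nodup_range
      · simpa [Nat.lt_succ_iff] using hi
      · simpa [Nat.lt_succ_iff] using hj
    · intro y hy
      rw [hlist, List.range_succ, List.map_append, List.map_singleton, List.dropLast_concat] at hy
      obtain ⟨i, hi, rfl⟩ := List.mem_map.1 hy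
      exact (hS _).1 (h.step i (List.mem_range.1 hi)).1
    · simp only [hlist, List.range_succ, List.map_append, List.map_singleton, List.getLast_concat]
      exact fun hmem => hn ((hS _).2 hmem)
  rw [latticeGamma, ENNReal.inv_le_iff_inv_le, ← ENNReal.ofReal_inv_of_pos (Real.exp_pos _),
    ← Real.exp_neg, ← hw]
  exact ENNReal.le_tsum (f := fun σ : {σ : List (Dir d) // IsExitPath Λ x σ} =>
    ENNReal.ofReal (pathWeight ω x σ.1)) ⟨σ, hexit⟩

/-- On the event `γ > t`, the product of the `ω(e) ^ (-a e)` over the edges that exit the vertices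
of `x + Λ` is at least of order `t ^ s`. -/
lemma mul_log_le_sum_of_lt_latticeGamma {Λ S : Finset (Fin d → ℤ)} {x : Fin d → ℤ}
    (hS : ∀ y, y ∈ S ↔ y - x ∈ Λ) {a : Dir d → ℝ} (ha : ∀ i, 0 ≤ a i) {s : ℝ} (hs : s ≤ kappa a)
    {ω : LatticeEnv d} {t : ℝ} (hd : 1 ≤ d) (ht : (Fintype.card (Dir d) : ℝ) ≤ t)
    (hω : ENNReal.ofReal t < latticeGamma Λ ω x) :
    s * (Real.log t - Real.log (Fintype.card (Dir d))) ≤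
      ∑ e : S × Dir d, a e.2 * latticeCost ω e.1 e.2 := by
  have hcard : (1 : ℝ) ≤ Fintype.card (Dir d) := by
    have : 1 ≤ Fintype.card (Dir d) := Fintype.card_pos_iff.2 ⟨Sum.inl ⟨0, hd⟩⟩
    exact_mod_cast this
  have hR : ∀ y z c, HasLatticeCost S ω y z c → 0 ≤ c := by
    rintro y z c ⟨-, i, -, rfl⟩
    exact latticeCost_nonneg ω y i
  refine mul_le_sum_of_forall_le_cut (src := fun e : S × Dir d => e.1.1)
    (tgt := fun e => e.1.1 + unitVec e.2) (fun e => ha e.2)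
    (fun e => latticeCost_nonneg ω e.1 e.2) (U := reachSet (HasLatticeCost S ω) x)
    monotone_reachSet (fun e r => reachSet_step hR ⟨e.1.2, e.2, rfl, rfl⟩)
    (Real.log_le_log (by linarith) ht) fun r hr hrt => ?_
  -- A path leaving `S` at cost below `log t` would give `γ ≤ t`. The ball is thus finite and the
  -- isoperimetric bound applies.
  have hsub : reachSet (HasLatticeCost S ω) x r ⊆ S := by
    rintro z ⟨n, p, c, hp, rfl, hc⟩
    by_contra hn
    refine (hp.latticeGamma_le hS hn).not_gt (lt_of_le_of_lt (ENNReal.ofReal_le_ofReal ?_) hω)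
    calc _ ≤ Real.exp (Real.log t) := Real.exp_le_exp.2 (hc.trans hrt.le)
      _ = t := Real.exp_log (by linarith)
  have hxU : x ∈ reachSet (HasLatticeCost S ω) x r :=
    self_mem_reachSet ((Real.log_nonneg hcard).trans hr)
  obtain ⟨k, hk⟩ := (ω x).exists_inv_card_le
  have hkU : x + unitVec k ∈ reachSet (HasLatticeCost S ω) x r := by
    refine monotone_reachSet ?_ (reachSet_step hR (u := latticeCost ω x k)
      ⟨hsub hxU, k, rfl, rfl⟩ (self_mem_reachSet le_rfl))
    rw [zero_add]
    refine le_trans ?_ hr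
    rw [latticeCost, neg_le, ← Real.log_inv]
    exact Real.log_le_log (by positivity) hk
  refine hs.trans ((kappa_le_sum_boundary ha hsub hxU hkU).trans_eq ?_)
  congr!

/-- The cut bound holds for every `t` below `γ`, so `γ ≤ 2d * exp (Q / s)`, where `Q` is the total
weighted cost. As `exp Q` is a product over sites, its mean factorizes. -/
lemma latticeGamma_rpow_le {Λ S : Finset (Fin d → ℤ)} {x : Fin d → ℤ}
    (hS : ∀ y, y ∈ S ↔ y - x ∈ Λ) {a : Dir d → ℝ} (ha : ∀ i, 0 ≤ a i) {s : ℝ} (hs0 : 0 < s)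
    (hs : s ≤ kappa a) (hd : 1 ≤ d) (ω : LatticeEnv d) :
    latticeGamma Λ ω x ^ s ≤ ENNReal.ofReal ((Fintype.card (Dir d) : ℝ) ^ s) *
      ∏ y ∈ S, ENNReal.ofReal (∏ i, (ω y).1 i ^ (-a i)) := by
  set Q : ℝ := ∑ e : S × Dir d, a e.2 * latticeCost ω e.1 e.2 with hQ
  set D : ℝ := (Fintype.card (Dir d) : ℝ) with hD
  have hD0 : 0 < D := by
    have : 0 < Fintype.card (Dir d) := Fintype.card_pos_iff.2 ⟨Sum.inl ⟨0, hd⟩⟩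
    exact Nat.cast_pos.2 this
  have hQ0 : 0 ≤ Q := Finset.sum_nonneg fun e _ => mul_nonneg (ha _) (latticeCost_nonneg _ _ _)
  have hprod : ∏ y ∈ S, ENNReal.ofReal (∏ i, (ω y).1 i ^ (-a i)) =
      ENNReal.ofReal (Real.exp Q) := by
    rw [← ENNReal.ofReal_prod_of_nonneg fun y _ => Finset.prod_nonneg fun i _ =>
      Real.rpow_nonneg ((ω y).2.1 i).le _, hQ, Real.exp_sum, Fintype.prod_prod_type,
      ← Finset.prod_coe_sort]
    congr 1
    refine Finset.prod_congr rfl fun y _ => Finset.prod_congr rfl fun i _ => ?_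
    rw [Real.rpow_def_of_pos ((ω y).2.1 i), latticeCost]
    ring_nf
  have hle : latticeGamma Λ ω x ≤ ENNReal.ofReal (D * Real.exp (Q / s)) := by
    by_contra! hlt
    obtain ⟨t, h1, h2⟩ := ENNReal.lt_iff_exists_nnreal_btwn.1 hlt
    have hB : D * Real.exp (Q / s) < t := by
      rw [← ENNReal.ofReal_coe_nnreal] at h1
      exact (ENNReal.ofReal_lt_ofReal_iff_of_nonneg (by positivity)).1 h1
    rw [← ENNReal.ofReal_coe_nnreal] at h2
    have hDB : D ≤ D * Real.exp (Q / s) :=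
      le_mul_of_one_le_right hD0.le (Real.one_le_exp (by positivity))
    have h3 := mul_log_le_sum_of_lt_latticeGamma hS ha hs hd (hDB.trans hB.le) h2
    have h4 := Real.log_lt_log (by positivity) hB
    rw [Real.log_mul hD0.ne' (Real.exp_pos _).ne', Real.log_exp] at h4
    have h5 : s * (Q / s) = Q := mul_div_cancel₀ Q hs0.ne'
    nlinarith
  calc latticeGamma Λ ω x ^ s ≤ ENNReal.ofReal (D * Real.exp (Q / s)) ^ s :=
        ENNReal.rpow_le_rpow hle hs0.le
    _ = ENNReal.ofReal (D ^ s) * ∏ y ∈ S, ENNReal.ofReal (∏ i, (ω y).1 i ^ (-a i)) := by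
        rw [hprod, ENNReal.ofReal_rpow_of_nonneg (by positivity) hs0.le,
          Real.mul_rpow hD0.le (Real.exp_pos _).le, ← Real.exp_mul, div_mul_cancel₀ _ hs0.ne',
          ENNReal.ofReal_mul (by positivity)]

lemma pathWeight_le_one (ω : LatticeEnv d) (x : Fin d → ℤ) (σ : List (Dir d)) :
    0 ≤ pathWeight ω x σ ∧ pathWeight ω x σ ≤ 1 := by
  induction σ generalizing x with
  | nil => simp [pathWeight]
  | cons i σ ih =>
    have h := ih (x + unitVec i)
    have h1 := (ω x).2.1 i
    exact ⟨mul_nonneg h1.le h.1, mul_le_one₀ (Simplex.le_one _ _) h.1 h.2⟩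

/-- The vertices before the last are distinct points of `x + Λ`, which bounds the length by
`Λ.card`. This serves for exponents `s ≤ 0`. -/
lemma finite_exitPath (Λ : Finset (Fin d → ℤ)) (x : Fin d → ℤ) :
    Finite {σ : List (Dir d) // IsExitPath Λ x σ} := by
  have hlen : ∀ (σ : List (Dir d)) (y : Fin d → ℤ), (trail y σ).length = σ.length := by
    intro σ
    induction σ with
    | nil => exact fun y => rfl
    | cons i σ ih => exact fun y => by simp [trail, ih]
  refine ((List.finite_length_le (Dir d) Λ.card).subset fun σ hσ => ?_).to_subtype
  have hnd : (((x :: trail x σ).dropLast).map (fun y => y - x)).Nodup :=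
    ((hσ.1.sublist (List.dropLast_sublist _)).map sub_left_injective)
  have hsub : (((x :: trail x σ).dropLast).map (fun y => y - x)).toFinset ⊆ Λ := by
    intro z hz
    obtain ⟨y, hy, rfl⟩ := List.mem_map.1 (List.mem_toFinset.1 hz)
    exact hσ.2.1 y hy
  have := Finset.card_le_card hsub
  rw [List.toFinset_card_of_nodup hnd] at this
  simpa [hlen] using this

/-- Lowering all weights by `ε` lowers `κ` by at most `2 * (2d) * ε`, because the subtracted
supremum also decreases. -/
lemma exists_exponent {α : Dir d → ℝ} (hα : ∀ i, 0 < α i) (hd : 1 ≤ d) {s : ℝ}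
    (hs : s < kappa α) :
    ∃ ε ∈ Set.Ioc (0 : ℝ) 1, (∀ i, 0 ≤ α i - ε) ∧ s ≤ kappa fun i => α i - ε := by
  have hne : Nonempty (Fin d) := ⟨⟨0, hd⟩⟩
  have hlim : Tendsto (fun ε : ℝ => kappa α - 2 * (Fintype.card (Dir d) * ε))
      (nhdsWithin 0 (Set.Ioi 0)) (nhds (kappa α)) := by
    refine tendsto_nhdsWithin_of_tendsto_nhds ?_
    have : Continuous fun ε : ℝ => kappa α - 2 * (Fintype.card (Dir d) * ε) := by fun_prop
    simpa using this.tendsto 0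
  have hid : Tendsto (fun ε : ℝ => ε) (nhdsWithin 0 (Set.Ioi 0)) (nhds 0) :=
    tendsto_nhdsWithin_of_tendsto_nhds tendsto_id
  obtain ⟨ε, h1, h2, h3, h4⟩ := ((hlim.eventually (lt_mem_nhds hs)).and
    ((hid.eventually (gt_mem_nhds one_pos)).and
      ((eventually_all.2 fun i => hid.eventually (gt_mem_nhds (hα i))).and
        self_mem_nhdsWithin))).exists
  refine ⟨ε, ⟨h4, h2.le⟩, fun i => sub_nonneg.2 (h3 i).le, h1.le.trans ?_⟩
  have h5 : ⨆ i : Fin d, ((α (Sum.inl i) - ε) + (α (Sum.inr i) - ε)) ≤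
      ⨆ i : Fin d, (α (Sum.inl i) + α (Sum.inr i)) := by
    refine ciSup_mono (Set.finite_range _).bddAbove fun i => ?_
    have : 0 < ε := h4
    linarith
  simp only [kappa, Finset.sum_sub_distrib, Finset.sum_const, Finset.card_univ, nsmul_eq_mul]
  linarith

/-- The moments of `γ` on the lattice. -/
theorem lintegral_latticeGamma_rpow_lt_top {α : Dir d → ℝ} (hα : ∀ i, 0 < α i) (hd : 1 ≤ d)
    (Λ : Finset (Fin d → ℤ)) (x : Fin d → ℤ) {s : ℝ} (hs : s < kappa α) :
    ∫⁻ ω, latticeGamma Λ ω x ^ s ∂(latticeLaw α) < ⊤ := by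
  have hne : Nonempty (Dir d) := ⟨Sum.inl ⟨0, hd⟩⟩
  have hprob := isProbabilityMeasure_dirichlet hα
  rcases le_or_gt s 0 with hs0 | hs0
  · have hprob' : IsProbabilityMeasure (latticeLaw α) :=
      inferInstanceAs (IsProbabilityMeasure (Measure.infinitePi fun _ => dirichlet α))
    have hfin := finite_exitPath Λ x
    set M : ℝ≥0∞ := ∑' _ : {σ : List (Dir d) // IsExitPath Λ x σ}, 1 with hM
    have hMtop : M ≠ ⊤ := by simpa [hM] using hfin
    -- For `s ≤ 0`, `γ ^ s` is the power `-s` of a sum of path weights, each at most `1`; `M` counts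
    -- the paths.
    have hle : ∀ ω : LatticeEnv d, latticeGamma Λ ω x ^ s ≤ M ^ (-s) := by
      intro ω
      rw [latticeGamma, ENNReal.inv_rpow, ← ENNReal.rpow_neg]
      refine ENNReal.rpow_le_rpow (ENNReal.tsum_le_tsum fun σ => ?_) (by linarith)
      exact ENNReal.ofReal_le_one.2 (pathWeight_le_one ω x σ.1).2
    refine (lintegral_mono hle).trans_lt ?_
    rw [lintegral_const, measure_univ, mul_one]
    exact ENNReal.rpow_lt_top_of_nonneg (by linarith) hMtop
  · obtain ⟨ε, hε, ha, hsε⟩ := exists_exponent hα hd hs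
    obtain ⟨C, hC, h⟩ := exists_lintegral_dirichlet_le hα
    let S : Finset (Fin d → ℤ) := Λ.map (addRightEmbedding x)
    have hS : ∀ y, y ∈ S ↔ y - x ∈ Λ := by
      intro y
      simp only [S, Finset.mem_map, addRightEmbedding_apply]
      exact ⟨fun ⟨z, hz, hzy⟩ => by simpa [← hzy] using hz, fun h => ⟨_, h, by simp⟩⟩
    refine (lintegral_mono fun ω => latticeGamma_rpow_le hS ha hs0 hsε hd ω).trans_lt ?_
    have hF : Measurable fun p : Simplex (Dir d) =>
        ENNReal.ofReal (∏ i, p.1 i ^ (-(α i - ε))) :=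
      (Finset.measurable_prod _ fun i _ =>
        ((measurable_pi_apply i).comp measurable_subtype_coe).pow_const _).ennreal_ofReal
    rw [lintegral_const_mul' _ _ ENNReal.ofReal_ne_top, latticeLaw,
      lintegral_infinitePi_prod (fun _ => dirichlet α) S fun _ => hF]
    refine ENNReal.mul_lt_top ENNReal.ofReal_lt_top (ENNReal.prod_lt_top fun y _ => ?_)
    simp only [neg_sub]
    exact (h ε hε).trans_lt ENNReal.ofReal_lt_top

end Lattice

end RWDE

theorem mainTheorem7 :
    -- finite directed graphs with a cemetery vertex
    (∀ (W : Type*) [Fintype W] [MeasurableSpace W] [DiscreteMeasurableSpace W]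
        (G : Digraph W) (δ : W) (α : W → W → ℝ) (o : W),
      RWDE.IsCemetery G δ →
      (∀ x, ¬ G.Adj x x) →
      (∀ x y, G.Adj x y → y ≠ δ → G.Adj y x) →
      (∀ x y, G.Adj x y → 0 < α x y) →
      o ≠ δ →
      -- the bound with `β` the minimum of the (finitely many) `β_A`
      (∀ β : ℝ, IsLeast (RWDE.exitSums G α o) β →
        ∃ C r : ℝ, 0 < C ∧ 0 < r ∧ ∀ᶠ t : ℝ in Filter.atTop,
          RWDE.envLaw G δ α {ω | ENNReal.ofReal t < RWDE.gamma ω o} ≤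
            ENNReal.ofReal (C * Real.log t ^ r / t ^ β)) ∧
      -- if there is no admissible `A`, the minimum is `+∞` and the bound is `0`
      (RWDE.exitSums G α o = ∅ → ∀ᶠ t : ℝ in Filter.atTop,
        RWDE.envLaw G δ α {ω | ENNReal.ofReal t < RWDE.gamma ω o} = 0)) ∧
    -- the lattice `ℤ^d`
    (∀ (d : ℕ) (α : RWDE.Dir d → ℝ) (Λ : Finset (Fin d → ℤ)),
      1 ≤ d →
      (∀ i, 0 < α i) →
      0 ∈ Λ →
      RWDE.IsConnectedSet Λ →
      ∀ (x : Fin d → ℤ) (s : ℝ), s < RWDE.kappa α →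
        ∫⁻ ω, RWDE.latticeGamma Λ ω x ^ s ∂(RWDE.latticeLaw α) < ⊤) := by
  refine ⟨?_, ?_⟩
  · intro W _ _ _ G δ α o hG _ hsymm hα ho
    exact ⟨fun β hβ => RWDE.gamma_tail hG hsymm hα ho hβ, RWDE.gamma_bounded hsymm ho⟩
  · intro d α Λ hd hα _ _ x s hs
    exact RWDE.lintegral_latticeGamma_rpow_lt_top hα hd Λ x hs
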